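/- Let $d,n\ge 0$ be integers. For $s\in\mathbb{Z}$ let $I_s(2t)=[z^s]\exp\bigl(t(z+z^{-1})\bigr)=\sum_{k\ge \max(0,-s)}\frac{t^{2k+s}}{k!\,(k+s)!}$, a formal power series in $t$. Then each of the following quantities is equal to $$\left[\frac{t^n}{n!}\right]\det\bigl(I_{i-j}(2t)+I_{i-j-1}(2t)\bigr)_{1\le i,j\le d},$$ where $[t^n/n!]$ denotes $n!$ times the coefficient of $t^n$. 1. The number of palindromic Weyl oscillating lattice walks of length $2n$ starting at $(d,d-1,\dots,1)$, that is, of sequences $w_0,\dots,w_{2n}$ of points of the Weyl chamber $\{x\in\mathbb{Z}^d: x_1>\dots>x_d>0\}$ with $w_0=(d,d-1,\dots,1)$, with every difference $w_i-w_{i-1}$ equal to plus or minus a unit coordinate vector, and with $w_i=w_{2n-i}$ for all $i$. 2. The number of palindromic oscillating tableaux of length $2n$ and height at most $d$. Here an oscillating tableau of shape $\mu$ and length $m$ is a sequence $\varnothing=\mu^0,\mu^1,\dots,\mu^m=\mu$ of Young diagrams, each obtained from the previous one by adding or removing one square; it has height at most $d$ if every $\mu^i$ has at most $d$ rows; and one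 of shape $\varnothing$ is palindromic if it is equal to its reversal. 3. The number of bilaterally symmetric $(d+1)$-noncrossing matchings on $[2n]=\{1,\dots,2n\}$, and also the number of bilaterally symmetric $(d+1)$-nonnesting matchings on $[2n]$. Here a matching is a partition of $[2n]$ into two-element blocks; it is bilaterally symmetric if it is invariant under $i\mapsto 2n+1-i$; and it is $k$-noncrossing (respectively $k$-nonnesting) if it has no $k$ blocks $\{a_1,b_1\},\dots,\{a_k,b_k\}$ with $a_1<\dots<a_k<b_1<\dots<b_k$ (respectively $a_1<\dots<a_k<b_k<\dots<b_1$). 4. The number of oscillating tableaux of length $n$, of any shape, and of height at most $d$. -/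

import Mathlib

namespace Osc

open Finset

/-- The hyperbolic Bessel function `I_s(2t) = [z^s] exp (t (z + z⁻¹))` of the first kind of integer
order `s`, as a formal power series in `t`. Since `exp (t (z + z⁻¹)) = exp (t z) * exp (t z⁻¹)`, the
coefficient of `t ^ m` is the sum of `1 / (k! l!)` over all `k + l = m` with `k - l = s`, that is
`1 / (l! (l + s)!)` if `m = 2 l + s` with `l, l + s ≥ 0`, and `0` otherwise. -/
noncomputable def besselI (s : ℤ) : PowerSeries ℚ :=
  PowerSeries.mk fun m =>
    ∑ p ∈ antidiagonal m,
      if (p.1 : ℤ) - (p.2 : ℤ) = s then 1 / ((p.1.factorial : ℚ) * (p.2.factorial : ℚ)) else 0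

/-- The matrix `(I_{i-j}(2t) + I_{i-j-1}(2t))_{1 ≤ i, j ≤ d}`. (Only `i - j` matters, so the
indices may start from `0`.) -/
noncomputable def besselMatrix (d : ℕ) : Matrix (Fin d) (Fin d) (PowerSeries ℚ) :=
  Matrix.of fun i j => besselI ((i : ℤ) - (j : ℤ)) + besselI ((i : ℤ) - (j : ℤ) - 1)

/-- The sequence `w_0, …, w_m` read backwards. -/
def reversal {α : Type*} {m : ℕ} (w : Fin (m + 1) → α) : Fin (m + 1) → α :=
  fun i => w i.rev

/-- A sequence is palindromic if it equals its reversal. -/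
def IsPalindromic {α : Type*} {m : ℕ} (w : Fin (m + 1) → α) : Prop :=
  w = reversal w

/-- The Weyl chamber `x_1 > ⋯ > x_d > 0` in `ℤ ^ d`. -/
def weylChamber (d : ℕ) : Set (Fin d → ℤ) :=
  {x | StrictAnti x ∧ ∀ i, 0 < x i}

/-- The point `(d, d - 1, …, 1)`. -/
def weylDelta (d : ℕ) : Fin d → ℤ :=
  fun i => (d : ℤ) - (i : ℤ)

/-- `w_0, …, w_m` is a Weyl oscillating lattice walk of length `m` starting at `x`. -/
structure IsWeylWalk {d m : ℕ} (x : Fin d → ℤ) (w : Fin (m + 1) → Fin d → ℤ) : Prop where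
  start : w 0 = x
  mem_chamber : ∀ i, w i ∈ weylChamber d
  step : ∀ i : Fin m, ∃ k : Fin d,
    w i.succ = w i.castSucc + Pi.single k 1 ∨ w i.succ = w i.castSucc - Pi.single k 1

/-- `ν` is obtained from `μ` by adding one square. -/
def AddsSquare (μ ν : YoungDiagram) : Prop :=
  ∃ c : ℕ × ℕ, c ∉ μ.cells ∧ ν.cells = insert c μ.cells

/-- `T_0, …, T_m` is an oscillating tableau of shape `μ` and length `m`. -/
structure IsOscillatingTableau {m : ℕ} (μ : YoungDiagram) (T : Fin (m + 1) → YoungDiagram) :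
    Prop where
  start : T 0 = ⊥
  shape : T (Fin.last m) = μ
  step : ∀ i : Fin m, AddsSquare (T i.castSucc) (T i.succ) ∨ AddsSquare (T i.succ) (T i.castSucc)

/-- Every diagram in the sequence has height (number of rows, i.e. length of the first column) at
most `d`. -/
def HeightLE {m : ℕ} (d : ℕ) (T : Fin (m + 1) → YoungDiagram) : Prop :=
  ∀ i, (T i).colLen 0 ≤ d

/-- Set partitions of `[2n]`; the element `i` of `[2n]` is `i - 1 : Fin (2 * n)`. -/
abbrev SetPartition (n : ℕ) : Type :=
  Finpartition (univ : Finset (Fin (2 * n)))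

/-- A matching on `[2n]` is a partition of `[2n]` into two-element blocks. -/
def IsMatching {n : ℕ} (M : SetPartition n) : Prop :=
  ∀ b ∈ M.parts, b.card = 2

/-- `(i, j)` with `i < j` is an edge. -/
def IsArc {n : ℕ} (M : SetPartition n) (i j : Fin (2 * n)) : Prop :=
  i < j ∧ {i, j} ∈ M.parts

/-- `M` has a `k`-crossing: arcs `(a_1, b_1), …, (a_k, b_k)` with
`a_1 < ⋯ < a_k < b_1 < ⋯ < b_k`. -/
def HasCrossing {n : ℕ} (k : ℕ) (M : SetPartition n) : Prop :=
  ∃ a b : Fin k → Fin (2 * n), StrictMono a ∧ StrictMono b ∧ (∀ r s, a r < b s) ∧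
    ∀ r, IsArc M (a r) (b r)

/-- `M` has a `k`-nesting: arcs `(a_1, b_1), …, (a_k, b_k)` with
`a_1 < ⋯ < a_k < b_k < ⋯ < b_1`. -/
def HasNesting {n : ℕ} (k : ℕ) (M : SetPartition n) : Prop :=
  ∃ a b : Fin k → Fin (2 * n), StrictMono a ∧ StrictAnti b ∧ (∀ r s, a r < b s) ∧
    ∀ r, IsArc M (a r) (b r)

/-- `M` is invariant under the reflection `i ↦ 2n + 1 - i` of `[2n]`. -/
def IsBilaterallySymmetric {n : ℕ} (M : SetPartition n) : Prop :=
  M.parts.image (fun b => b.image Fin.rev) = M.parts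

/-- Palindromic Weyl oscillating lattice walks of length `2n` starting at `(d, …, 1)`. -/
def palindromicWalks (d n : ℕ) : Set (Fin (2 * n + 1) → Fin d → ℤ) :=
  {w | IsWeylWalk (weylDelta d) w ∧ IsPalindromic w}

/-- Palindromic oscillating tableaux (necessarily of empty shape) of length `2n` and of height
at most `d`. -/
def palindromicTableaux (d n : ℕ) : Set (Fin (2 * n + 1) → YoungDiagram) :=
  {T | IsOscillatingTableau ⊥ T ∧ HeightLE d T ∧ IsPalindromic T}

/-- Bilaterally symmetric `(d + 1)`-noncrossing matchings on `[2n]`. -/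
def symmetricNoncrossing (d n : ℕ) : Set (SetPartition n) :=
  {M | IsMatching M ∧ IsBilaterallySymmetric M ∧ ¬ HasCrossing (d + 1) M}

/-- Bilaterally symmetric `(d + 1)`-nonnesting matchings on `[2n]`. -/
def symmetricNonnesting (d n : ℕ) : Set (SetPartition n) :=
  {M | IsMatching M ∧ IsBilaterallySymmetric M ∧ ¬ HasNesting (d + 1) M}

/-- Oscillating tableaux of any shape, of length `n` and of height at most `d`. -/
def boundedTableaux (d n : ℕ) : Set (Fin (n + 1) → YoungDiagram) :=
  {T | (∃ μ, IsOscillatingTableau μ T) ∧ HeightLE d T}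

end Osc

/-!
A palindromic path is determined by its first half, so the palindromic walks are the walks of length
`n` that start at `(d, …, 1)` and stay in the chamber, the palindromic tableaux are the tableaux of
length `n` and height at most `d`, and `μ ↦ μ + (d, …, 1)` identifies the two. A matching of `[2n]`
is a 0/1 filling of a staircase, and the boundary of the growth diagram (Fomin) of this filling is
a closed oscillating tableau. Reflecting the matching transposes the filling and thereby reverses
the tableau. By Greene's theorem, crossings and nestings of arcs become rows and columns of its
diagrams, and transposing the diagrams turns a bound on the columns into a bound on the rows.

For the determinant, let `φ` be the antisymmetric extension of the indicator function of the chamber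
`0 < y_1 < ⋯ < y_d` to the positive orthant. By the reflection principle the number of walks from
`(1, …, d)` is the pairing of `φ` with `∏ (z_i ^ i - z_i ^ (-i)) * (∑ (z_i + z_i⁻¹)) ^ n`, that is,
up to the factor `d!`, with `det (z_i ^ j - z_i ^ (-j)) * (∑ (z_i + z_i⁻¹)) ^ n`. This symplectic
alternant is `∏ (1 - z_i⁻¹) * ∏_{i < j} (1 - z_i⁻¹ z_j⁻¹)` times the ordinary alternant
`det (z_i ^ (j - 1) + z_i ^ j)`. By Littlewood's identity the generating function `∑ φ(y) z ^ y` is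
`∏ z_i * ∏_{i < j} (z_j - z_i)` divided by `∏ (1 - z_i) * ∏_{i < j} (1 - z_i z_j)`, so the adjoint
of the first factor turns `φ` into the antisymmetrization of the single point `(1, …, d)`. What
remains is the determinant of the series `I_{i-j} + I_{i-j-1}`.
-/

namespace Osc

open Finset

/-! ### Growth diagrams -/

/-- Last-passage percolation through the weights `x` of the cells of the quarter plane: the maximal
weight of a path of cells going north or east in the rectangle `[0, i) × [0, j)`. -/
def chainLen (x : ℕ → ℕ → ℕ) : ℕ → ℕ → ℕ
  | 0, _ => 0
  | _ + 1, 0 => 0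
  | i + 1, j + 1 => max (chainLen x i (j + 1)) (chainLen x (i + 1) j) + x i j

/-- The corners of Viennot's shadow lines of the filling `x`. -/
def shadow (x : ℕ → ℕ → ℕ) (i j : ℕ) : ℕ :=
  min (chainLen x i (j + 1)) (chainLen x (i + 1) j) - chainLen x i j

/-- Fomin's growth diagram of the filling `x`: the `k`-th row length (from `k = 0`) of the partition
at the lattice point `(i, j)`. -/
def growthRow (x : ℕ → ℕ → ℕ) (k : ℕ) : ℕ → ℕ → ℕ :=
  chainLen (shadow^[k] x)

section ChainLen

variable (x : ℕ → ℕ → ℕ)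

@[simp] lemma chainLen_zero_left (j : ℕ) : chainLen x 0 j = 0 := by rw [chainLen]

@[simp] lemma chainLen_zero_right (i : ℕ) : chainLen x i 0 = 0 := by
  cases i <;> rw [chainLen]

lemma chainLen_succ_succ (i j : ℕ) : chainLen x (i + 1) (j + 1) =
    max (chainLen x i (j + 1)) (chainLen x (i + 1) j) + x i j := by
  rw [chainLen]

lemma chainLen_le_succ_left (i j : ℕ) : chainLen x i j ≤ chainLen x (i + 1) j := by
  cases j with
  | zero => simp
  | succ j => rw [chainLen_succ_succ]; omega

lemma chainLen_le_succ_right (i j : ℕ) : chainLen x i j ≤ chainLen x i (j + 1) := by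
  cases i with
  | zero => simp
  | succ i => rw [chainLen_succ_succ]; omega

lemma chainLen_mono {i i' j j' : ℕ} (hi : i ≤ i') (hj : j ≤ j') :
    chainLen x i j ≤ chainLen x i' j' :=
  (monotone_nat_of_le_succ (fun i => chainLen_le_succ_left x i j) hi).trans
    (monotone_nat_of_le_succ (chainLen_le_succ_right x i') hj)

lemma chainLen_eq_zero_iff {i j : ℕ} :
    chainLen x i j = 0 ↔ ∀ a < i, ∀ b < j, x a b = 0 := by
  constructor
  · intro h a ha b hb
    have hle := chainLen_mono x (Nat.succ_le_of_lt ha) (Nat.succ_le_of_lt hb)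
    rw [Nat.succ_eq_add_one, Nat.succ_eq_add_one, chainLen_succ_succ] at hle
    omega
  · induction i generalizing j with
    | zero => simp
    | succ i ih =>
      induction j with
      | zero => simp
      | succ j ihj =>
        intro h
        rw [chainLen_succ_succ, ih fun a ha => h a (by omega),
          ihj fun a ha b hb => h a ha b (by omega), h i (by omega) j (by omega), max_self]

lemma chainLen_swap (i j : ℕ) : chainLen (Function.swap x) i j = chainLen x j i := by
  induction i generalizing j with
  | zero => simp
  | succ i ih =>
    induction j with
    | zero => simp
    | succ j ihj => rw [chainLen_succ_succ, chainLen_succ_succ, ihj, ih, max_comm]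

lemma chainLen_add_shadow (i j : ℕ) : chainLen x i j + shadow x i j =
    min (chainLen x i (j + 1)) (chainLen x (i + 1) j) := by
  have := chainLen_le_succ_left x i j
  have := chainLen_le_succ_right x i j
  rw [shadow]
  omega

lemma shadow_ne_zero_iff {i j : ℕ} : shadow x i j ≠ 0 ↔
    chainLen x i (j + 1) ≠ chainLen x i j ∧ chainLen x (i + 1) j ≠ chainLen x i j := by
  have := chainLen_add_shadow x i j
  have := chainLen_le_succ_left x i j
  have := chainLen_le_succ_right x i j
  omega

lemma shadow_swap : shadow (Function.swap x) = Function.swap (shadow x) := by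
  funext i j
  simp only [shadow, chainLen_swap, Function.swap, min_comm]

lemma chainLen_add_sum_shadow_row (i j : ℕ) :
    chainLen x (i + 1) j + ∑ b ∈ range j, shadow x i b =
      chainLen x i j + ∑ b ∈ range j, x i b := by
  induction j with
  | zero => simp
  | succ j ih =>
    rw [sum_range_succ, sum_range_succ, chainLen_succ_succ]
    have := chainLen_add_shadow x i j
    omega

lemma chainLen_add_sum_shadow_col (i j : ℕ) :
    chainLen x i (j + 1) + ∑ a ∈ range i, shadow x a j =
      chainLen x i j + ∑ a ∈ range i, x a j := by
  simpa only [chainLen_swap, shadow_swap] using chainLen_add_sum_shadow_row (Function.swap x) j i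

lemma chainLen_shadow_le (i j : ℕ) : chainLen (shadow x) (i + 1) j ≤ chainLen x i j ∧
    chainLen (shadow x) i (j + 1) ≤ chainLen x i j := by
  have step (i j) (hleft : chainLen (shadow x) (i + 1) j ≤ chainLen x i j)
      (hright : chainLen (shadow x) i (j + 1) ≤ chainLen x i j) :
      chainLen (shadow x) (i + 1) (j + 1) ≤ min (chainLen x i (j + 1)) (chainLen x (i + 1) j) := by
    rw [chainLen_succ_succ, ← chainLen_add_shadow]
    omega
  induction i generalizing j with
  | zero =>
    refine ⟨?_, by simp⟩
    induction j with
    | zero => simp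
    | succ j ih => exact (step 0 j ih (by simp)).trans (min_le_left _ _)
  | succ i ih =>
    have hright (j) : chainLen (shadow x) (i + 1) (j + 1) ≤ chainLen x (i + 1) j :=
      (step i j (ih j).1 (ih j).2).trans (min_le_right _ _)
    refine ⟨?_, hright j⟩
    induction j with
    | zero => simp
    | succ j ihj => exact (step (i + 1) j ihj (hright j)).trans (min_le_left _ _)

end ChainLen

section GrowthRow

variable (x : ℕ → ℕ → ℕ)

@[simp] lemma growthRow_zero_left (k j : ℕ) : growthRow x k 0 j = 0 := chainLen_zero_left _ _

@[simp] lemma growthRow_zero_right (k i : ℕ) : growthRow x k i 0 = 0 := chainLen_zero_right _ _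

lemma growthRow_succ (k : ℕ) : growthRow x (k + 1) = chainLen (shadow (shadow^[k] x)) := by
  rw [growthRow, Function.iterate_succ_apply']

lemma growthRow_swap (k i j : ℕ) : growthRow (Function.swap x) k i j = growthRow x k j i := by
  have hswap : Function.Commute shadow Function.swap := shadow_swap
  rw [growthRow, hswap.iterate_left k x, chainLen_swap, growthRow]

/-- Fomin's local rule away from the points of the filling, with both sides moved so that no
subtraction occurs. -/
lemma growthRow_succ_add_growthRow (k i j : ℕ) :
    growthRow x (k + 1) (i + 1) (j + 1) + growthRow x k i j =
      max (growthRow x (k + 1) i (j + 1)) (growthRow x (k + 1) (i + 1) j) +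
      min (growthRow x k i (j + 1)) (growthRow x k (i + 1) j) := by
  rw [growthRow_succ, chainLen_succ_succ, growthRow, ← chainLen_add_shadow]
  omega

lemma growthRow_succ_le_left (k i j : ℕ) : growthRow x (k + 1) (i + 1) j ≤ growthRow x k i j := by
  rw [growthRow_succ]
  exact (chainLen_shadow_le _ i j).1

lemma antitone_growthRow (i j : ℕ) : Antitone fun k => growthRow x k i j :=
  antitone_nat_of_succ_le fun k =>
    (chainLen_le_succ_left _ i j).trans (growthRow_succ_le_left x k i j)

lemma growthRow_eq_zero_of_le {k i : ℕ} (h : i ≤ k) (j : ℕ) : growthRow x k i j = 0 := by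
  induction k generalizing i with
  | zero => simp [Nat.le_zero.1 h]
  | succ k ih =>
    cases i with
    | zero => simp
    | succ i => exact Nat.le_zero.1 ((growthRow_succ_le_left x k i j).trans (ih (by omega)).le)

lemma iterate_shadow_eq_zero {k i : ℕ} (h : i < k) (j : ℕ) : (shadow^[k] x) i j = 0 := by
  obtain ⟨k, rfl⟩ := Nat.exists_eq_add_one_of_ne_zero h.ne_bot
  have hzero : chainLen (shadow^[k] x) i (j + 1) = 0 :=
    growthRow_eq_zero_of_le x (Nat.lt_succ_iff.1 h) (j + 1)
  rw [Function.iterate_succ_apply', shadow, hzero]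
  simp

lemma sum_growthRow_add_sum_iterate_shadow (K i j : ℕ) :
    ∑ k ∈ range K, growthRow x k (i + 1) j + ∑ b ∈ range j, (shadow^[K] x) i b =
      ∑ k ∈ range K, growthRow x k i j + ∑ b ∈ range j, x i b := by
  induction K with
  | zero => simp
  | succ K ih =>
    have hrow := chainLen_add_sum_shadow_row (shadow^[K] x) i j
    rw [sum_range_succ, sum_range_succ, Function.iterate_succ_apply']
    simp only [growthRow] at ih ⊢
    omega

lemma sum_growthRow_succ_left {K i : ℕ} (hK : i < K) (j : ℕ) :
    ∑ k ∈ range K, growthRow x k (i + 1) j =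
      ∑ k ∈ range K, growthRow x k i j + ∑ b ∈ range j, x i b := by
  rw [← sum_growthRow_add_sum_iterate_shadow x K i j,
    sum_eq_zero (s := range j) fun b _ => iterate_shadow_eq_zero x hK b, add_zero]

end GrowthRow

/-! ### Viennot's geometric construction -/

/-- The filling `x` is a partial permutation matrix: every row and every column has at most one
nonzero entry, and that entry is `1`. -/
structure IsPartialPerm (x : ℕ → ℕ → ℕ) : Prop where
  row : ∀ i j, ∑ b ∈ range j, x i b ≤ 1
  col : ∀ i j, ∑ a ∈ range i, x a j ≤ 1

namespace IsPartialPerm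

variable {x : ℕ → ℕ → ℕ}

lemma swap (hx : IsPartialPerm x) : IsPartialPerm (Function.swap x) :=
  ⟨fun i j => hx.col j i, fun i j => hx.row j i⟩

protected lemma shadow (hx : IsPartialPerm x) : IsPartialPerm (shadow x) where
  row i j := by
    have := chainLen_add_sum_shadow_row x i j
    have := chainLen_le_succ_left x i j
    have := hx.row i j
    omega
  col i j := by
    have := chainLen_add_sum_shadow_col x i j
    have := chainLen_le_succ_right x i j
    have := hx.col i j
    omega

lemma iterate_shadow (hx : IsPartialPerm x) (k : ℕ) : IsPartialPerm (shadow^[k] x) := by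
  induction k with
  | zero => exact hx
  | succ k ih => rw [Function.iterate_succ_apply']; exact ih.shadow

lemma row_unique (hx : IsPartialPerm x) {i j j' : ℕ} (h : x i j ≠ 0) (h' : x i j' ≠ 0) :
    j = j' := by
  by_contra hne
  have hpair : ∑ b ∈ {j, j'}, x i b ≤ ∑ b ∈ range (max j j' + 1), x i b :=
    sum_le_sum_of_subset fun b hb => by
      simp only [mem_insert, mem_singleton] at hb
      simp only [mem_range]
      omega
  have := hx.row i (max j j' + 1)
  rw [sum_pair hne] at hpair
  omega

lemma chainLen_succ_left_of_ne (hx : IsPartialPerm x) {i j : ℕ} (h : x i j ≠ 0) :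
    chainLen x (i + 1) j = chainLen x i j := by
  have := chainLen_add_sum_shadow_row x i j
  have := chainLen_le_succ_left x i j
  have hrow := hx.row i (j + 1)
  rw [sum_range_succ] at hrow
  omega

lemma chainLen_succ_right_of_ne (hx : IsPartialPerm x) {i j : ℕ} (h : x i j ≠ 0) :
    chainLen x i (j + 1) = chainLen x i j := by
  simpa only [chainLen_swap] using hx.swap.chainLen_succ_left_of_ne (i := j) (j := i) h

lemma chainLen_succ_succ_of_ne (hx : IsPartialPerm x) {i j : ℕ} (h : x i j ≠ 0) :
    chainLen x (i + 1) (j + 1) = chainLen x i j + 1 := by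
  have hrow := hx.row i (j + 1)
  rw [sum_range_succ] at hrow
  rw [chainLen_succ_succ, hx.chainLen_succ_left_of_ne h, hx.chainLen_succ_right_of_ne h, max_self]
  omega

/-- A shadow line crosses column `j` at height `i` exactly if `chainLen x i (j + 1)` and
`chainLen x i j` differ; traced downwards, it starts at a point of the filling. -/
lemma exists_source_col {i j : ℕ} (h : chainLen x i (j + 1) ≠ chainLen x i j) :
    ∃ s < i, x s j ≠ 0 ∧
      ∀ i', s < i' → i' ≤ i → chainLen x i' (j + 1) ≠ chainLen x i' j := by
  induction i with
  | zero => simp at h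
  | succ i ih =>
    by_cases hij : x i j = 0
    · have hi : chainLen x i (j + 1) ≠ chainLen x i j := by
        rw [chainLen_succ_succ, hij] at h
        have := chainLen_le_succ_left x i j
        omega
      obtain ⟨s, hs, hxs, hcross⟩ := ih hi
      refine ⟨s, by omega, hxs, fun i' hsi' hi'i => ?_⟩
      rcases Nat.le_succ_iff.1 hi'i with hle | rfl
      exacts [hcross i' hsi' hle, h]
    · refine ⟨i, by omega, hij, fun i' hii' hi'i => ?_⟩
      obtain rfl : i' = i + 1 := by omega
      exact h

lemma exists_source_row {i j : ℕ} (h : chainLen x (i + 1) j ≠ chainLen x i j) :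
    ∃ s < j, x i s ≠ 0 ∧
      ∀ j', s < j' → j' ≤ j → chainLen x (i + 1) j' ≠ chainLen x i j' := by
  rw [← chainLen_swap x j (i + 1), ← chainLen_swap x j i] at h
  simpa only [chainLen_swap] using exists_source_col h

lemma chainLen_succ_right_ne_of_shadow_eq_zero (hx : IsPartialPerm x) {s i j : ℕ}
    (h : x s j ≠ 0) (hi : s < i) (hs : ∀ i', s < i' → i' < i → shadow x i' j = 0) :
    chainLen x i (j + 1) ≠ chainLen x i j := by
  induction i, hi using Nat.le_induction with
  | base => rw [hx.chainLen_succ_succ_of_ne h, hx.chainLen_succ_left_of_ne h]; omega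
  | succ i hi ih =>
    have hcross := ih fun i' hsi' hi'i => hs i' hsi' (by omega)
    have hcorner := mt (fun h' => (shadow_ne_zero_iff x).2 ⟨hcross, h'⟩)
      (not_not.2 (hs i (by omega) (by omega)))
    have := chainLen_le_succ_right x i j
    rw [chainLen_succ_succ]
    omega

lemma chainLen_succ_left_ne_of_shadow_eq_zero (hx : IsPartialPerm x) {i s j : ℕ}
    (h : x i s ≠ 0) (hj : s < j) (hs : ∀ j', s < j' → j' < j → shadow x i j' = 0) :
    chainLen x (i + 1) j ≠ chainLen x i j := by
  have := hx.swap.chainLen_succ_right_ne_of_shadow_eq_zero (s := s) (i := j) (j := i) h hj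
    (by simpa only [shadow_swap] using hs)
  simpa only [chainLen_swap] using this

lemma exists_shadow_between (hx : IsPartialPerm x) {i j i' j' : ℕ} (h : x i j ≠ 0)
    (h' : x i' j' ≠ 0) (hi : i < i') (hj : j' < j) :
    ∃ u v, i < u ∧ u ≤ i' ∧ j' < v ∧ v ≤ j ∧ shadow x u v ≠ 0 := by
  by_contra! hnone
  have hcol := hx.chainLen_succ_right_ne_of_shadow_eq_zero h hi
    fun u hu hu' => hnone u j hu hu'.le hj le_rfl
  have hrow := hx.chainLen_succ_left_ne_of_shadow_eq_zero h' hj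
    fun v hv hv' => hnone i' v hi le_rfl hv hv'.le
  exact (shadow_ne_zero_iff x).2 ⟨hcol, hrow⟩ (hnone i' j hi le_rfl hj le_rfl)

lemma exists_between_shadow (hx : IsPartialPerm x) {u v u' v' : ℕ} (h : shadow x u v ≠ 0)
    (h' : shadow x u' v' ≠ 0) (hu : u < u') (hv : v' < v) :
    ∃ i j, u ≤ i ∧ i < u' ∧ v' ≤ j ∧ j < v ∧ x i j ≠ 0 := by
  obtain ⟨t, htv, hxt, hrow⟩ := exists_source_row ((shadow_ne_zero_iff x).1 h).2
  obtain ⟨s, hsu, hxs, hcol⟩ := exists_source_col ((shadow_ne_zero_iff x).1 h').1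
  by_cases ht : v' ≤ t
  · exact ⟨u, t, le_rfl, hu, ht, htv, hxt⟩
  by_cases hs : u ≤ s
  · exact ⟨s, v', hs, hsu, le_rfl, hv, hxs⟩
  -- Otherwise the two shadow lines cross at `(u, v')`, which is a second corner in row `u`.
  have hcorner := (shadow_ne_zero_iff x).2 ⟨hcol u (by omega) hu.le, hrow v' (by omega) hv.le⟩
  have := hx.shadow.row_unique hcorner h
  omega

end IsPartialPerm

/-- `x` has `k` points in strictly decreasing position in the rectangle `[0, I) × [0, J)`. -/
def HasAntichain (x : ℕ → ℕ → ℕ) (k I J : ℕ) : Prop :=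
  ∃ a b : Fin k → ℕ, StrictMono a ∧ StrictAnti b ∧
    ∀ r, a r < I ∧ b r < J ∧ x (a r) (b r) ≠ 0

/-- `x` has `k` points in strictly increasing position in the rectangle `[0, I) × [0, J)`. -/
def HasChain (x : ℕ → ℕ → ℕ) (k I J : ℕ) : Prop :=
  ∃ a b : Fin k → ℕ, StrictMono a ∧ StrictMono b ∧
    ∀ r, a r < I ∧ b r < J ∧ x (a r) (b r) ≠ 0

section Greene

variable {x : ℕ → ℕ → ℕ}

lemma hasAntichain_one_iff {I J : ℕ} : HasAntichain x 1 I J ↔ chainLen x I J ≠ 0 := by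
  rw [ne_eq, chainLen_eq_zero_iff]
  push Not
  constructor
  · rintro ⟨a, b, -, -, hab⟩
    exact ⟨a 0, (hab 0).1, b 0, (hab 0).2⟩
  · rintro ⟨i, hi, j, hj, hij⟩
    exact ⟨fun _ => i, fun _ => j, Subsingleton.strictMono _, Subsingleton.strictAnti _,
      fun _ => ⟨hi, hj, hij⟩⟩

namespace IsPartialPerm

lemma exists_interlacing (hx : IsPartialPerm x) {k I J : ℕ} {u v : Fin (k + 1) → ℕ}
    (hu : StrictMono u) (hv : StrictAnti v)
    (huv : ∀ r, u r < I ∧ v r < J ∧ shadow x (u r) (v r) ≠ 0) (m : Fin (k + 2)) :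
    ∃ i j, (i < I ∧ j < J ∧ x i j ≠ 0) ∧ (∀ l : Fin (k + 1), l.succ = m → u l ≤ i ∧ j < v l) ∧
      ∀ l : Fin (k + 1), l.castSucc = m → i < u l ∧ v l ≤ j := by
  cases m using Fin.cases with
  | zero =>
    obtain ⟨s, hs, hxs, -⟩ := exists_source_col ((shadow_ne_zero_iff x).1 (huv 0).2.2).1
    refine ⟨s, v 0, ⟨hs.trans (huv 0).1, (huv 0).2.1, hxs⟩,
      fun l hl => absurd hl l.succ_ne_zero, fun l hl => ?_⟩
    obtain rfl : l = 0 := Fin.castSucc_injective _ hl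
    exact ⟨hs, le_rfl⟩
  | succ m =>
    cases m using Fin.lastCases with
    | last =>
      obtain ⟨t, ht, hxt, -⟩ :=
        exists_source_row ((shadow_ne_zero_iff x).1 (huv (Fin.last k)).2.2).2
      refine ⟨u (Fin.last k), t, ⟨(huv _).1, ht.trans (huv _).2.1, hxt⟩, fun l hl => ?_,
        fun l hl => absurd hl (Fin.castSucc_ne_last l)⟩
      obtain rfl := Fin.succ_injective _ hl
      exact ⟨le_rfl, ht⟩
    | cast m =>
      obtain ⟨i, j, hi, hi', hj, hj', hij⟩ := hx.exists_between_shadow (huv m.castSucc).2.2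
        (huv m.succ).2.2 (hu m.castSucc_lt_succ) (hv m.castSucc_lt_succ)
      refine ⟨i, j, ⟨hi'.trans (huv _).1, hj'.trans (huv _).2.1, hij⟩, fun l hl => ?_,
        fun l hl => ?_⟩
      · obtain rfl := Fin.succ_injective _ hl
        exact ⟨hi, hj'⟩
      · obtain rfl : l = m.succ := Fin.castSucc_injective _ hl
        exact ⟨hi', hj⟩

lemma hasAntichain_succ_of_shadow (hx : IsPartialPerm x) {k I J : ℕ}
    (h : HasAntichain (shadow x) (k + 1) I J) : HasAntichain x (k + 2) I J := by
  obtain ⟨u, v, hu, hv, huv⟩ := h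
  choose a b hab hpred hsucc using hx.exists_interlacing hu hv huv
  exact ⟨a, b,
    Fin.strictMono_iff_lt_succ.2 fun m => (hsucc _ m rfl).1.trans_le (hpred _ m rfl).1,
    Fin.strictAnti_iff_succ_lt.2 fun m => (hpred _ m rfl).2.trans_le (hsucc _ m rfl).2, hab⟩

lemma hasAntichain_shadow_of_succ (hx : IsPartialPerm x) {k I J : ℕ}
    (h : HasAntichain x (k + 2) I J) : HasAntichain (shadow x) (k + 1) I J := by
  obtain ⟨a, b, ha, hb, hab⟩ := h
  choose u v hau hua hbv hvb huv using fun m : Fin (k + 1) => hx.exists_shadow_between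
    (hab m.castSucc).2.2 (hab m.succ).2.2 (ha m.castSucc_lt_succ) (hb m.castSucc_lt_succ)
  refine ⟨u, v, Fin.strictMono_iff_lt_succ.2 fun m => ?_, Fin.strictAnti_iff_succ_lt.2 fun m => ?_,
    fun r => ⟨(hua r).trans_lt (hab _).1, (hvb r).trans_lt (hab _).2.1, huv r⟩⟩
  · exact (hua m.castSucc).trans_lt (Fin.succ_castSucc m ▸ hau m.succ)
  · exact (hvb m.succ).trans_lt (Fin.succ_castSucc m ▸ hbv m.castSucc)

/-- The last part of Greene's theorem: `growthRow x d I J ≠ 0` says that the partition at `(I, J)`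
has more than `d` rows. -/
theorem growthRow_ne_zero_iff (hx : IsPartialPerm x) (d I J : ℕ) :
    growthRow x d I J ≠ 0 ↔ HasAntichain x (d + 1) I J := by
  suffices H : ∀ k, HasAntichain (shadow^[d] x) (k + 1) I J ↔ HasAntichain x (d + k + 1) I J by
    rw [growthRow, ← hasAntichain_one_iff]
    exact H 0
  induction d with
  | zero => intro k; rw [zero_add, Function.iterate_zero_apply]
  | succ d ih =>
    intro k
    have hd := hx.iterate_shadow d
    rw [Function.iterate_succ_apply', add_right_comm d 1 k, add_assoc d k 1, ← ih (k + 1)]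
    exact ⟨hd.hasAntichain_succ_of_shadow, hd.hasAntichain_shadow_of_succ⟩

end IsPartialPerm

lemma hasChain_zero {I J : ℕ} : HasChain x 0 I J :=
  ⟨Fin.elim0, Fin.elim0, Subsingleton.strictMono _, Subsingleton.strictMono _, fun r => r.elim0⟩

lemma HasChain.mono {k I J I' J' : ℕ} (h : HasChain x k I J) (hI : I ≤ I') (hJ : J ≤ J') :
    HasChain x k I' J' := by
  obtain ⟨a, b, ha, hb, hab⟩ := h
  exact ⟨a, b, ha, hb, fun r =>
    ⟨(hab r).1.trans_le hI, (hab r).2.1.trans_le hJ, (hab r).2.2⟩⟩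

lemma strictMono_snoc {α : Type*} [Preorder α] {k : ℕ} {a : Fin k → α} (ha : StrictMono a) {i : α}
    (hi : ∀ r, a r < i) : StrictMono (Fin.snoc a i : Fin (k + 1) → α) := by
  rw [← Fin.insertNth_last', Fin.strictMono_insertNth_iff]
  exact ⟨ha, fun r _ => hi r, fun r hr => absurd hr (Fin.castSucc_lt_last r).not_ge⟩

lemma HasChain.snoc {k i j : ℕ} (h : HasChain x k i j) (hij : x i j ≠ 0) :
    HasChain x (k + 1) (i + 1) (j + 1) := by
  obtain ⟨a, b, ha, hb, hab⟩ := h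
  refine ⟨Fin.snoc a i, Fin.snoc b j, strictMono_snoc ha fun r => (hab r).1,
    strictMono_snoc hb fun r => (hab r).2.1, fun r => ?_⟩
  cases r using Fin.lastCases with
  | last => simpa using hij
  | cast r =>
    simp only [Fin.snoc_castSucc]
    exact ⟨(hab r).1.trans i.lt_succ_self, (hab r).2.1.trans j.lt_succ_self, (hab r).2.2⟩

namespace IsPartialPerm

lemma hasChain_of_le_chainLen (hx : IsPartialPerm x) {k I J : ℕ} (hk : k ≤ chainLen x I J) :
    HasChain x k I J := by
  induction I generalizing k J with
  | zero =>
    obtain rfl := Nat.le_zero.1 (hk.trans_eq (chainLen_zero_left x J))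
    exact hasChain_zero
  | succ I ihI =>
    induction J generalizing k with
    | zero =>
      obtain rfl := Nat.le_zero.1 (hk.trans_eq (chainLen_zero_right x (I + 1)))
      exact hasChain_zero
    | succ J ihJ =>
      by_cases hIJ : x I J = 0
      · rw [chainLen_succ_succ, hIJ, add_zero, le_max_iff] at hk
        rcases hk with hk | hk
        · exact (ihI hk).mono I.le_succ le_rfl
        · exact (ihJ hk).mono le_rfl J.le_succ
      · rw [hx.chainLen_succ_succ_of_ne hIJ] at hk
        cases k with
        | zero => exact hasChain_zero
        | succ k => exact (ihI (Nat.succ_le_succ_iff.1 hk)).snoc hIJ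

lemma le_chainLen_of_hasChain (hx : IsPartialPerm x) {k I J : ℕ} (h : HasChain x k I J) :
    k ≤ chainLen x I J := by
  induction k generalizing I J with
  | zero => exact Nat.zero_le _
  | succ k ih =>
    obtain ⟨a, b, ha, hb, hab⟩ := h
    have hlast (r : Fin k) := Fin.castSucc_lt_last r
    have hinit := ih ⟨fun r => a r.castSucc, fun r => b r.castSucc,
      ha.comp Fin.strictMono_castSucc, hb.comp Fin.strictMono_castSucc,
      fun r => ⟨ha (hlast r), hb (hlast r), (hab _).2.2⟩⟩
    obtain ⟨haI, hbJ, hne⟩ := hab (Fin.last k)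
    calc k + 1 ≤ chainLen x (a (Fin.last k) + 1) (b (Fin.last k) + 1) := by
          rw [hx.chainLen_succ_succ_of_ne hne]
          exact Nat.succ_le_succ hinit
      _ ≤ chainLen x I J := chainLen_mono x haI hbJ

/-- The first part of Greene's theorem, since `chainLen x = growthRow x 0`. -/
theorem le_chainLen_iff (hx : IsPartialPerm x) (k I J : ℕ) :
    k ≤ chainLen x I J ↔ HasChain x k I J :=
  ⟨hx.hasChain_of_le_chainLen, hx.le_chainLen_of_hasChain⟩

end IsPartialPerm

end Greene

/-! ### Arc diagrams and oscillating sequences of partitions -/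

/-- The vector `g` arises from `f` by adding `1` to a single entry. -/
def AddsOne {ι R : Type*} [DecidableEq ι] [AddMonoidWithOne R] (f g : ι → R) : Prop :=
  ∃ k, g = f + Pi.single k 1

/-- The `0`-`1` filling of the staircase `i + j + 2 ≤ N` by a perfect matching of `0, …, N - 1`:
the arc `p < q` is recorded as a `1` in the cell `(p, N - 1 - q)`, so that row `p` and column
`N - 1 - p` together contain a single `1`. -/
structure IsArcFilling (N : ℕ) (x : ℕ → ℕ → ℕ) : Prop where
  zero : ∀ i j, N ≤ i + j + 1 → x i j = 0
  one : ∀ p < N, ∑ b ∈ range (N - 1 - p), x p b + ∑ a ∈ range p, x a (N - 1 - p) = 1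

/-- A closed oscillating tableau of length `N`, encoded by row lengths: the `p`-th partition is
`T p 0 ≥ T p 1 ≥ ⋯`. The values `T p` with `N < p` are irrelevant. -/
structure IsOscSeq (N : ℕ) (T : ℕ → ℕ → ℕ) : Prop where
  start : ∀ k, T 0 k = 0
  finish : ∀ k, T N k = 0
  anti : ∀ p ≤ N, Antitone (T p)
  step : ∀ p < N, AddsOne (T p) (T (p + 1)) ∨ AddsOne (T (p + 1)) (T p)

/-- The partitions on the outer boundary of the growth diagram of a filling of the staircase. -/
def growthSeq (N : ℕ) (x : ℕ → ℕ → ℕ) (p k : ℕ) : ℕ := growthRow x k p (N - p)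

/-- The growth diagram computed inwards from its boundary `T` by inverting the local rules:
`inwardShape T m p` is the partition at the lattice point `(p, N - p - m)`. -/
def inwardShape (T : ℕ → ℕ → ℕ) : ℕ → ℕ → ℕ → ℕ
  | 0, p, k => T p k
  | 1, p, k => min (T p k) (T (p + 1) k)
  | m + 2, p, k =>
    max (inwardShape T (m + 1) p (k + 1)) (inwardShape T (m + 1) (p + 1) (k + 1)) +
      min (inwardShape T (m + 1) p k) (inwardShape T (m + 1) (p + 1) k) -
      inwardShape T m (p + 1) (k + 1)

/-- The skew shape `g / f` is a horizontal strip. -/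
def IsHorizontalStrip (f g : ℕ → ℕ) : Prop := ∀ k, f k ≤ g k ∧ g (k + 1) ≤ f k

lemma addsOne_iff {ι R : Type*} [DecidableEq ι] [AddMonoidWithOne R] {f g : ι → R} :
    AddsOne f g ↔ ∃ k, ∀ l, g l = f l + if l = k then 1 else 0 := by
  simp only [AddsOne, funext_iff, Pi.add_apply, Pi.single_apply]

namespace AddsOne

variable {f g : ℕ → ℕ}

lemma le (h : AddsOne f g) : f ≤ g := by
  obtain ⟨k, rfl⟩ := h
  exact le_self_add

lemma sum_range (h : AddsOne f g) {K : ℕ} (hg : ∀ k, K ≤ k → g k = 0) :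
    ∑ k ∈ range K, g k = ∑ k ∈ range K, f k + 1 := by
  obtain ⟨k, rfl⟩ := h
  have hk : k < K := by
    by_contra! hKk
    simpa using hg k hKk
  simp only [Pi.add_apply, sum_add_distrib, sum_pi_single', mem_range, hk, if_true]

lemma isHorizontalStrip (h : AddsOne f g) (hf : Antitone f) (hg : Antitone g) :
    IsHorizontalStrip f g := by
  obtain ⟨k, hk⟩ := addsOne_iff.1 h
  refine fun l => ⟨h.le l, ?_⟩
  have hfl := hf l.le_succ
  have hgl := hg l.le_succ
  rw [Nat.succ_eq_add_one, hk l, hk (l + 1)] at hgl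
  rw [hk (l + 1)]
  split_ifs at hgl ⊢ <;> omega

end AddsOne

lemma isHorizontalStrip_self {f : ℕ → ℕ} (hf : Antitone f) : IsHorizontalStrip f f :=
  fun k => ⟨le_rfl, hf k.le_succ⟩

section GrowthStep

variable {x : ℕ → ℕ → ℕ} {i j : ℕ}

lemma antitone_sum_iterate_shadow_row (x : ℕ → ℕ → ℕ) (i j : ℕ) :
    Antitone fun k => ∑ b ∈ range j, (shadow^[k] x) i b := by
  refine antitone_nat_of_succ_le fun k => ?_
  have hrow := chainLen_add_sum_shadow_row (shadow^[k] x) i j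
  have := chainLen_le_succ_left (shadow^[k] x) i j
  rw [Function.iterate_succ_apply']
  omega

lemma growthRow_add_sum_iterate_shadow_row (x : ℕ → ℕ → ℕ) (k i j : ℕ) :
    growthRow x k (i + 1) j + ∑ b ∈ range j, (shadow^[k + 1] x) i b =
      growthRow x k i j + ∑ b ∈ range j, (shadow^[k] x) i b := by
  rw [Function.iterate_succ_apply']
  exact chainLen_add_sum_shadow_row _ i j

lemma growthRow_succ_left_of_sum_eq_zero (h : ∑ b ∈ range j, x i b = 0) (k : ℕ) :
    growthRow x k (i + 1) j = growthRow x k i j := by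
  have hzero (k) : ∑ b ∈ range j, (shadow^[k] x) i b = 0 :=
    Nat.le_zero.1 ((antitone_sum_iterate_shadow_row x i j k.zero_le).trans_eq h)
  simpa only [hzero, add_zero] using growthRow_add_sum_iterate_shadow_row x k i j

lemma exists_eq_ite_of_antitone {S : ℕ → ℕ} (hS : Antitone S) (hone : S 0 = 1) {K : ℕ}
    (hzero : S K = 0) : ∃ m, ∀ k, S k = if k ≤ m then 1 else 0 := by
  induction K with
  | zero => omega
  | succ K ih =>
    by_cases hK : S K = 0
    · exact ih hK
    · refine ⟨K, fun k => ?_⟩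
      have hk := hone ▸ hS k.zero_le
      split_ifs with hkK
      · have := hS hkK
        omega
      · exact Nat.le_zero.1 (hzero ▸ hS (Nat.lt_of_not_ge hkK))

lemma addsOne_growthRow_left (h : ∑ b ∈ range j, x i b = 1) :
    AddsOne (fun k => growthRow x k i j) fun k => growthRow x k (i + 1) j := by
  obtain ⟨m, hm⟩ := exists_eq_ite_of_antitone (antitone_sum_iterate_shadow_row x i j) h
    (K := i + 1) (sum_eq_zero fun b _ => iterate_shadow_eq_zero x i.lt_succ_self b)
  refine addsOne_iff.2 ⟨m, fun k => ?_⟩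
  have hrow := growthRow_add_sum_iterate_shadow_row x k i j
  rw [hm, hm] at hrow
  split_ifs at hrow ⊢ <;> omega

lemma growthRow_succ_right_of_sum_eq_zero (h : ∑ a ∈ range i, x a j = 0) (k : ℕ) :
    growthRow x k i (j + 1) = growthRow x k i j := by
  simpa only [growthRow_swap] using
    growthRow_succ_left_of_sum_eq_zero (x := Function.swap x) (i := j) (j := i) h k

lemma addsOne_growthRow_right (h : ∑ a ∈ range i, x a j = 1) :
    AddsOne (fun k => growthRow x k i j) fun k => growthRow x k i (j + 1) := by
  simpa only [growthRow_swap] using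
    addsOne_growthRow_left (x := Function.swap x) (i := j) (j := i) h

end GrowthStep

lemma growthSeq_swap {N : ℕ} (x : ℕ → ℕ → ℕ) {p : ℕ} (hp : p ≤ N) :
    growthSeq N (Function.swap x) p = growthSeq N x (N - p) := by
  funext k
  rw [growthSeq, growthSeq, growthRow_swap, Nat.sub_sub_self hp]

lemma growthSeq_eq_zero_of_le {N : ℕ} (x : ℕ → ℕ → ℕ) {p : ℕ} (hp : N ≤ p) :
    growthSeq N x p = 0 := by
  funext k
  rw [growthSeq, Nat.sub_eq_zero_of_le hp, growthRow_zero_right, Pi.zero_apply]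

namespace IsArcFilling

variable {N : ℕ} {x y : ℕ → ℕ → ℕ}

lemma swap (hx : IsArcFilling N x) : IsArcFilling N (Function.swap x) := by
  refine ⟨fun i j h => hx.zero j i (by omega), fun p hp => ?_⟩
  have hone := hx.one (N - 1 - p) (by omega)
  rwa [Nat.sub_sub_self (by omega), add_comm] at hone

lemma sum_row_le_one (hx : IsArcFilling N x) (i j : ℕ) : ∑ b ∈ range j, x i b ≤ 1 := by
  by_cases hi : i < N
  · calc ∑ b ∈ range j, x i b ≤ ∑ b ∈ range (N - 1 - i), x i b :=
          sum_le_sum_of_ne_zero fun b _ hb => by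
            have := mt (hx.zero i b) hb
            rw [mem_range]
            omega
      _ ≤ 1 := (Nat.le_add_right _ _).trans_eq (hx.one i hi)
  · rw [sum_eq_zero fun b _ => hx.zero i b (by omega)]
    exact zero_le_one

lemma isPartialPerm (hx : IsArcFilling N x) : IsPartialPerm x :=
  ⟨hx.sum_row_le_one, fun i j => hx.swap.sum_row_le_one j i⟩

lemma growthRow_step (hx : IsArcFilling N x) {i j : ℕ} (hij : i + j + 1 = N) :
    ((∀ k, growthRow x k (i + 1) j = growthRow x k i j) ∧
      AddsOne (fun k => growthRow x k i j) fun k => growthRow x k i (j + 1)) ∨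
    ((∀ k, growthRow x k i (j + 1) = growthRow x k i j) ∧
      AddsOne (fun k => growthRow x k i j) fun k => growthRow x k (i + 1) j) := by
  have hone := hx.one i (by omega)
  rw [show N - 1 - i = j by omega, Nat.add_eq_one_iff] at hone
  rcases hone with ⟨hrow, hcol⟩ | ⟨hrow, hcol⟩
  · exact Or.inl ⟨growthRow_succ_left_of_sum_eq_zero hrow, addsOne_growthRow_right hcol⟩
  · exact Or.inr ⟨growthRow_succ_right_of_sum_eq_zero hcol, addsOne_growthRow_left hrow⟩

lemma isOscSeq (hx : IsArcFilling N x) : IsOscSeq N (growthSeq N x) := by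
  refine ⟨fun k => growthRow_zero_left x k _, fun k => ?_, fun p _ => antitone_growthRow x _ _,
    fun p hp => ?_⟩
  · rw [growthSeq_eq_zero_of_le x le_rfl, Pi.zero_apply]
  · have hp' : growthSeq N x p = fun k => growthRow x k p (N - (p + 1) + 1) := by
      funext k
      rw [growthSeq, show N - (p + 1) + 1 = N - p by omega]
    have hsucc : growthSeq N x (p + 1) = fun k => growthRow x k (p + 1) (N - (p + 1)) := rfl
    rw [hp', hsucc]
    rcases hx.growthRow_step (i := p) (j := N - (p + 1)) (by omega) with ⟨heq, hadd⟩ | ⟨heq, hadd⟩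
    · simpa only [heq] using Or.inr hadd
    · simpa only [heq] using Or.inl hadd

lemma growthRow_eq_min (hx : IsArcFilling N x) {i j : ℕ} (hij : i + j + 1 = N) (k : ℕ) :
    growthRow x k i j = min (growthRow x k i (j + 1)) (growthRow x k (i + 1) j) := by
  have hright : growthRow x k i j ≤ growthRow x k i (j + 1) := chainLen_le_succ_right _ _ _
  have hleft : growthRow x k i j ≤ growthRow x k (i + 1) j := chainLen_le_succ_left _ _ _
  rcases hx.growthRow_step hij with ⟨heq, -⟩ | ⟨heq, -⟩
  · rw [heq, min_eq_right hright]
  · rw [heq, min_eq_left hleft]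

lemma growthRow_eq_inwardShape (hx : IsArcFilling N x) :
    ∀ {m i j : ℕ}, i + j + m = N → ∀ k, growthRow x k i j = inwardShape (growthSeq N x) m i k
  | 0, i, j, h, k => by rw [inwardShape, growthSeq, show N - i = j by omega]
  | 1, i, j, h, k => by
    rw [hx.growthRow_eq_min h, inwardShape, growthSeq, growthSeq, show N - i = j + 1 by omega,
      show N - (i + 1) = j by omega]
  | m + 2, i, j, h, k => by
    have hrule := growthRow_succ_add_growthRow x k i j
    rw [hx.growthRow_eq_inwardShape (m := m) (by omega),
      hx.growthRow_eq_inwardShape (m := m + 1) (j := j + 1) (by omega) (k + 1),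
      hx.growthRow_eq_inwardShape (m := m + 1) (i := i + 1) (by omega) (k + 1),
      hx.growthRow_eq_inwardShape (m := m + 1) (j := j + 1) (by omega) k,
      hx.growthRow_eq_inwardShape (m := m + 1) (i := i + 1) (by omega) k] at hrule
    rw [inwardShape]
    omega

theorem eq_of_growthSeq_eq (hx : IsArcFilling N x) (hy : IsArcFilling N y)
    (h : ∀ p ≤ N, growthSeq N x p = growthSeq N y p) : x = y := by
  have hseq : growthSeq N x = growthSeq N y := funext fun p => by
    rcases le_total p N with hp | hp
    · exact h p hp
    · rw [growthSeq_eq_zero_of_le x hp, growthSeq_eq_zero_of_le y hp]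
  have hchain {i j : ℕ} (hij : i + j ≤ N) : chainLen x i j = chainLen y i j := by
    have hm : i + j + (N - (i + j)) = N := by omega
    exact (hx.growthRow_eq_inwardShape hm 0).trans
      (hseq ▸ (hy.growthRow_eq_inwardShape hm 0).symm)
  funext i j
  by_cases hij : N ≤ i + j + 1
  · rw [hx.zero i j hij, hy.zero i j hij]
  · have hcell := hchain (i := i + 1) (j := j + 1) (by omega)
    rw [chainLen_succ_succ, chainLen_succ_succ, hchain (i := i) (by omega),
      hchain (j := j) (by omega)] at hcell
    exact Nat.add_left_cancel hcell

lemma swap_eq_self_iff (hx : IsArcFilling N x) : Function.swap x = x ↔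
    ∀ p ≤ N, growthSeq N x p = growthSeq N x (N - p) := by
  constructor
  · intro h p hp
    rw [← growthSeq_swap x hp, h]
  · intro h
    exact hx.swap.eq_of_growthSeq_eq hx fun p hp => by rw [growthSeq_swap x hp, h p hp]

end IsArcFilling

section Inverse

/-- The entry of the growth diagram with boundary `T` at the lattice point `(i, j)`, where
`i + j ≤ N`, arranged as in `growthRow`. -/
def inwardRow (N : ℕ) (T : ℕ → ℕ → ℕ) (k i j : ℕ) : ℕ := inwardShape T (N - i - j) i k

/-- The filling of the staircase whose iterated chain lengths are `inwardRow N T k`; it is the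
`k`-th iterated shadow of the filling with boundary `T`. -/
def inwardFilling (N : ℕ) (T : ℕ → ℕ → ℕ) (k i j : ℕ) : ℕ :=
  if N ≤ i + j + 1 then 0
  else inwardRow N T k (i + 1) (j + 1) - max (inwardRow N T k i (j + 1)) (inwardRow N T k (i + 1) j)

namespace IsOscSeq

variable {N : ℕ} {T : ℕ → ℕ → ℕ}

lemma eq_zero_of_le (hT : IsOscSeq N T) {p : ℕ} (hp : p ≤ N) {k : ℕ} (hk : p ≤ k) :
    T p k = 0 := by
  induction p generalizing k with
  | zero => exact hT.start k
  | succ p ih =>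
    obtain ⟨k, rfl⟩ := Nat.exists_eq_succ_of_ne_zero (Nat.ne_zero_of_lt hk)
    have hprev := ih (by omega) (show p ≤ k by omega)
    have hprev_succ := ih (by omega) (show p ≤ k + 1 by omega)
    rcases hT.step p (by omega) with hadd | hremove
    · exact Nat.le_zero.1 ((hadd.isHorizontalStrip (hT.anti p (by omega))
        (hT.anti (p + 1) hp) k).2.trans_eq hprev)
    · exact Nat.le_zero.1 ((hremove.le (k + 1)).trans_eq hprev_succ)

lemma inwardShape_strip (hT : IsOscSeq N T) {m p : ℕ} (h : p + m + 1 ≤ N) :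
    IsHorizontalStrip (inwardShape T (m + 1) p) (inwardShape T m p) ∧
    IsHorizontalStrip (inwardShape T (m + 1) p) (inwardShape T m (p + 1)) := by
  induction m generalizing p with
  | zero =>
    have hanti := hT.anti p (by omega)
    have hanti_succ := hT.anti (p + 1) h
    rcases hT.step p h with hadd | hremove
    · have hmin : inwardShape T 1 p = T p := funext fun k => min_eq_left (hadd.le k)
      rw [hmin]
      exact ⟨isHorizontalStrip_self hanti, hadd.isHorizontalStrip hanti hanti_succ⟩
    · have hmin : inwardShape T 1 p = T (p + 1) := funext fun k => min_eq_right (hremove.le k)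
      rw [hmin]
      exact ⟨hremove.isHorizontalStrip hanti_succ hanti, isHorizontalStrip_self hanti_succ⟩
  | succ m ih =>
    have hbounds (k) : inwardShape T (m + 2) p k ≤
        min (inwardShape T (m + 1) p k) (inwardShape T (m + 1) (p + 1) k) ∧
        max (inwardShape T (m + 1) p (k + 1)) (inwardShape T (m + 1) (p + 1) (k + 1)) ≤
        inwardShape T (m + 2) p k := by
      have hleft := (ih (p := p) (by omega)).2
      have hright := (ih (p := p + 1) (by omega)).1
      have := hleft k
      have := hright k
      have := hleft (k + 1)
      have := hright (k + 1)
      rw [inwardShape]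
      omega
    exact ⟨fun k => ⟨(hbounds k).1.trans (min_le_left _ _), (le_max_left _ _).trans (hbounds k).2⟩,
      fun k => ⟨(hbounds k).1.trans (min_le_right _ _), (le_max_right _ _).trans (hbounds k).2⟩⟩

lemma inwardShape_le_left (hT : IsOscSeq N T) {m p : ℕ} (h : p + m ≤ N) (k : ℕ) :
    inwardShape T m p k ≤ T p k := by
  induction m with
  | zero => exact le_rfl
  | succ m ih => exact ((hT.inwardShape_strip h).1 k).1.trans (ih (by omega))

lemma inwardShape_le_right (hT : IsOscSeq N T) {m p : ℕ} (h : p + m ≤ N) (k : ℕ) :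
    inwardShape T m p k ≤ T (p + m) k := by
  induction m generalizing p with
  | zero => exact le_rfl
  | succ m ih =>
    rw [← add_assoc, add_right_comm]
    exact ((hT.inwardShape_strip h).2 k).1.trans (ih (by omega))

lemma inwardRow_zero_left (hT : IsOscSeq N T) {j : ℕ} (hj : j ≤ N) (k : ℕ) :
    inwardRow N T k 0 j = 0 :=
  Nat.le_zero.1 ((hT.inwardShape_le_left (by omega) k).trans_eq (hT.start k))

lemma inwardRow_zero_right (hT : IsOscSeq N T) {i : ℕ} (hi : i ≤ N) (k : ℕ) :
    inwardRow N T k i 0 = 0 := by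
  refine Nat.le_zero.1 ((hT.inwardShape_le_right (by omega) k).trans_eq ?_)
  rw [show i + (N - i - 0) = N by omega, hT.finish]

lemma max_inwardRow_le (hT : IsOscSeq N T) {i j : ℕ} (h : i + j + 2 ≤ N) (k : ℕ) :
    max (inwardRow N T k i (j + 1)) (inwardRow N T k (i + 1) j) ≤
      inwardRow N T k (i + 1) (j + 1) := by
  obtain ⟨m, rfl⟩ := Nat.exists_eq_add_of_le h
  have hleft := (hT.inwardShape_strip (m := m) (p := i) (by omega)).2 k
  have hright := (hT.inwardShape_strip (m := m) (p := i + 1) (by omega)).1 k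
  rw [inwardRow, inwardRow, inwardRow, show i + j + 2 + m - i - (j + 1) = m + 1 by omega,
    show i + j + 2 + m - (i + 1) - j = m + 1 by omega,
    show i + j + 2 + m - (i + 1) - (j + 1) = m by omega]
  exact max_le hleft.1 hright.1

lemma inwardRow_succ_add_inwardRow (hT : IsOscSeq N T) {i j : ℕ} (h : i + j + 2 ≤ N) (k : ℕ) :
    inwardRow N T (k + 1) (i + 1) (j + 1) + inwardRow N T k i j =
      max (inwardRow N T (k + 1) i (j + 1)) (inwardRow N T (k + 1) (i + 1) j) +
      min (inwardRow N T k i (j + 1)) (inwardRow N T k (i + 1) j) := by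
  obtain ⟨m, rfl⟩ := Nat.exists_eq_add_of_le h
  have hleft := (hT.inwardShape_strip (m := m) (p := i) (by omega)).2 k
  have hright := (hT.inwardShape_strip (m := m) (p := i + 1) (by omega)).1 k
  simp only [inwardRow]
  rw [show i + j + 2 + m - i - (j + 1) = m + 1 by omega,
    show i + j + 2 + m - (i + 1) - j = m + 1 by omega,
    show i + j + 2 + m - (i + 1) - (j + 1) = m by omega,
    show i + j + 2 + m - i - j = m + 2 by omega, inwardShape]
  omega

lemma chainLen_eq_inwardRow (hT : IsOscSeq N T) {y : ℕ → ℕ → ℕ} {k : ℕ}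
    (hy : ∀ i j, i + j + 2 ≤ N → y i j = inwardFilling N T k i j) :
    ∀ {i j : ℕ}, i + j ≤ N → chainLen y i j = inwardRow N T k i j
  | 0, j, h => by rw [chainLen_zero_left, hT.inwardRow_zero_left (by omega)]
  | i + 1, 0, h => by rw [chainLen_zero_right, hT.inwardRow_zero_right (by omega)]
  | i + 1, j + 1, h => by
    rw [chainLen_succ_succ, hT.chainLen_eq_inwardRow hy (i := i) (by omega),
      hT.chainLen_eq_inwardRow hy (j := j) (by omega), hy i j (by omega), inwardFilling,
      if_neg (by omega), Nat.add_sub_of_le (hT.max_inwardRow_le (by omega) k)]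

lemma iterate_shadow_inwardFilling (hT : IsOscSeq N T) (k : ℕ) {i j : ℕ} (h : i + j + 2 ≤ N) :
    (shadow^[k] (inwardFilling N T 0)) i j = inwardFilling N T k i j := by
  induction k generalizing i j with
  | zero => rfl
  | succ k ih =>
    have hchain {a b : ℕ} (hab : a + b ≤ N) :=
      hT.chainLen_eq_inwardRow (fun i j hij => ih (i := i) (j := j) hij) hab
    rw [Function.iterate_succ_apply', shadow, hchain (by omega), hchain (by omega),
      hchain (by omega), inwardFilling, if_neg (by omega)]
    have := hT.inwardRow_succ_add_inwardRow h k
    have := hT.max_inwardRow_le h (k + 1)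
    omega

lemma growthRow_inwardFilling (hT : IsOscSeq N T) (k : ℕ) {i j : ℕ} (h : i + j ≤ N) :
    growthRow (inwardFilling N T 0) k i j = inwardRow N T k i j :=
  hT.chainLen_eq_inwardRow (fun _ _ => hT.iterate_shadow_inwardFilling k) h

lemma growthSeq_inwardFilling (hT : IsOscSeq N T) {p : ℕ} (hp : p ≤ N) :
    growthSeq N (inwardFilling N T 0) p = T p := by
  funext k
  rw [growthSeq, hT.growthRow_inwardFilling k (by omega), inwardRow, Nat.sub_self, inwardShape]

lemma sum_inwardFilling (hT : IsOscSeq N T) {p : ℕ} (hp : p < N) :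
    ∑ b ∈ range (N - 1 - p), inwardFilling N T 0 p b +
      ∑ a ∈ range p, inwardFilling N T 0 a (N - 1 - p) = 1 := by
  set x := inwardFilling N T 0
  have hcorner (k) : growthRow x k p (N - 1 - p) = min (T p k) (T (p + 1) k) := by
    rw [hT.growthRow_inwardFilling k (by omega), inwardRow, show N - p - (N - 1 - p) = 1 by omega,
      inwardShape]
  have hbelow (k) : growthRow x k (p + 1) (N - 1 - p) = T (p + 1) k := by
    rw [← hT.growthSeq_inwardFilling (p := p + 1) hp, growthSeq, Nat.sub_sub, add_comm 1 p]
  have hright (k) : growthRow x k p (N - 1 - p + 1) = T p k := by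
    rw [← hT.growthSeq_inwardFilling hp.le, growthSeq, show N - p = N - 1 - p + 1 by omega]
  have hrow := sum_growthRow_succ_left x (K := N + 1) (i := p) (by omega) (N - 1 - p)
  have hcol := sum_growthRow_succ_left (Function.swap x) (K := N + 1) (i := N - 1 - p) (by omega) p
  simp only [growthRow_swap, Function.swap, hcorner, hbelow, hright] at hrow hcol
  rcases hT.step p hp with hadd | hremove
  · have := hadd.sum_range (K := N + 1) fun k hk => hT.eq_zero_of_le hp (by omega)
    simp only [min_eq_left (hadd.le _)] at hrow hcol
    omega
  · have := hremove.sum_range (K := N + 1) fun k hk => hT.eq_zero_of_le hp.le (by omega)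
    simp only [min_eq_right (hremove.le _)] at hrow hcol
    omega

theorem exists_isArcFilling (hT : IsOscSeq N T) :
    ∃ x, IsArcFilling N x ∧ ∀ p ≤ N, growthSeq N x p = T p :=
  ⟨inwardFilling N T 0, ⟨fun _ _ h => if_pos h, fun _ => hT.sum_inwardFilling⟩,
    fun _ => hT.growthSeq_inwardFilling⟩

end IsOscSeq

end Inverse

section YoungDiagram

lemma youngDiagram_ext {μ ν : YoungDiagram} (h : μ.rowLen = ν.rowLen) : μ = ν := by
  refine SetLike.ext fun c => ?_
  rw [YoungDiagram.mem_iff_lt_rowLen, YoungDiagram.mem_iff_lt_rowLen, h]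

/-- The largest Young diagram with at most `K` rows in which the row lengths are bounded by `f`; for
antitone `f` with `f K = 0` these are its row lengths. -/
def ofRowLen (K : ℕ) (f : ℕ → ℕ) : YoungDiagram where
  cells := (range K ×ˢ range (f 0)).filter fun c => ∀ i ≤ c.1, c.2 < f i
  isLowerSet := by
    rintro ⟨i, j⟩ ⟨i', j'⟩ hle hmem
    obtain ⟨hi, hj⟩ := Prod.mk_le_mk.1 hle
    rw [mem_coe, mem_filter, mem_product, mem_range, mem_range] at hmem ⊢
    exact ⟨⟨hi.trans_lt hmem.1.1, hj.trans_lt hmem.1.2⟩,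
      fun a ha => hj.trans_lt (hmem.2 a (ha.trans hi))⟩

lemma rowLen_ofRowLen {f : ℕ → ℕ} (hf : Antitone f) {K : ℕ} (hK : f K = 0) :
    (ofRowLen K f).rowLen = f := by
  funext k
  refine eq_of_forall_lt_iff fun j => ?_
  rw [← YoungDiagram.mem_iff_lt_rowLen, ← YoungDiagram.mem_cells, ofRowLen, mem_filter,
    mem_product, mem_range, mem_range]
  refine ⟨fun h => h.2 k le_rfl, fun hj => ⟨⟨?_, hj.trans_le (hf k.zero_le)⟩,
    fun i hi => hj.trans_le (hf hi)⟩⟩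
  by_contra! hKk
  exact Nat.not_lt_zero j (hK ▸ hj.trans_le (hf hKk))

lemma rowLen_eq_zero_iff {μ : YoungDiagram} {d : ℕ} : μ.rowLen d = 0 ↔ μ.colLen 0 ≤ d := by
  rw [← not_iff_not, not_le, ← YoungDiagram.mem_iff_lt_colLen, YoungDiagram.mem_iff_lt_rowLen,
    Nat.pos_iff_ne_zero]

lemma rowLen_bot : (⊥ : YoungDiagram).rowLen = 0 := by
  funext k
  by_contra h
  exact YoungDiagram.notMem_bot _ (YoungDiagram.mem_iff_lt_rowLen.2 (Nat.pos_of_ne_zero h))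

lemma transpose_bot : (⊥ : YoungDiagram).transpose = ⊥ := by
  refine SetLike.ext fun c => ?_
  simp only [YoungDiagram.mem_transpose, YoungDiagram.notMem_bot]

lemma addsSquare_iff {μ ν : YoungDiagram} : AddsSquare μ ν ↔ AddsOne μ.rowLen ν.rowLen := by
  rw [addsOne_iff]
  constructor
  · rintro ⟨⟨i, j⟩, hc, hν⟩
    refine ⟨i, fun l => ?_⟩
    rw [YoungDiagram.rowLen_eq_card, YoungDiagram.rowLen_eq_card, YoungDiagram.row,
      YoungDiagram.row, hν, filter_insert]
    by_cases hl : i = l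
    · rw [if_pos hl, if_pos hl.symm, card_insert_of_notMem fun h => hc (mem_filter.1 h).1]
    · rw [if_neg hl, if_neg (Ne.symm hl), add_zero]
  · rintro ⟨i, hi⟩
    refine ⟨(i, μ.rowLen i), fun h => lt_irrefl _ (YoungDiagram.mem_iff_lt_rowLen.1 h), ?_⟩
    ext ⟨a, b⟩
    rw [mem_insert, YoungDiagram.mem_cells, YoungDiagram.mem_cells,
      YoungDiagram.mem_iff_lt_rowLen, YoungDiagram.mem_iff_lt_rowLen, hi a, Prod.mk.injEq]
    by_cases ha : a = i
    · subst ha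
      rw [if_pos rfl]
      omega
    · rw [if_neg ha]
      omega

lemma AddsSquare.transpose {μ ν : YoungDiagram} (h : AddsSquare μ ν) :
    AddsSquare μ.transpose ν.transpose := by
  obtain ⟨c, hc, hν⟩ := h
  refine ⟨c.swap, ?_, ?_⟩
  · rwa [YoungDiagram.mem_cells, YoungDiagram.mem_transpose, Prod.swap_swap]
  · ext a
    rw [mem_insert, YoungDiagram.mem_cells, YoungDiagram.mem_cells, YoungDiagram.mem_transpose,
      YoungDiagram.mem_transpose, ← YoungDiagram.mem_cells, hν, mem_insert,
      YoungDiagram.mem_cells, Prod.swap_eq_iff_eq_swap]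

end YoungDiagram

/-! ### Matchings as fillings of the staircase -/

section ArcWeight

variable {N : ℕ} {x : ℕ → ℕ → ℕ}

/-- The symmetric matrix of the arc diagram encoded by the filling `x` of the staircase: its entry
at `p < q` is the entry of `x` in the cell `(p, N - 1 - q)`, and its diagonal vanishes. -/
def arcWeight (x : ℕ → ℕ → ℕ) (p q : Fin N) : ℕ :=
  if p < q then x p q.rev else if q < p then x q p.rev else 0

lemma arcWeight_comm (x : ℕ → ℕ → ℕ) (p q : Fin N) : arcWeight x p q = arcWeight x q p := by
  rcases lt_trichotomy p q with h | rfl | h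
  · rw [arcWeight, arcWeight, if_pos h, if_neg h.asymm, if_pos h]
  · rfl
  · rw [arcWeight, arcWeight, if_neg h.asymm, if_pos h, if_pos h]

lemma arcWeight_of_lt (x : ℕ → ℕ → ℕ) {p q : Fin N} (h : p < q) : arcWeight x p q = x p q.rev :=
  if_pos h

lemma arcWeight_self (x : ℕ → ℕ → ℕ) (p : Fin N) : arcWeight x p p = 0 := by
  rw [arcWeight, if_neg (lt_irrefl p), if_neg (lt_irrefl p)]

lemma sum_univ_ite_lt {f : ℕ → ℕ} {k : ℕ} (hk : k ≤ N) :
    ∑ q : Fin N, (if q.val < k then f q else 0) = ∑ a ∈ range k, f a := by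
  rw [Fin.sum_univ_eq_sum_range fun a => if a < k then f a else 0, ← sum_filter]
  congr 1
  ext a
  rw [mem_filter, mem_range, mem_range]
  omega

lemma sum_arcWeight (x : ℕ → ℕ → ℕ) (p : Fin N) : ∑ q, arcWeight x p q =
    ∑ b ∈ range (N - 1 - p), x p b + ∑ a ∈ range p, x a (N - 1 - p) := by
  have hright : ∑ q, (if p < q then x p (Fin.rev q) else 0) = ∑ b ∈ range (N - 1 - p), x p b := by
    rw [← sum_univ_ite_lt (N := N) (by omega), ← Equiv.sum_comp Fin.revPerm]
    refine sum_congr rfl fun q _ => ?_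
    rw [Fin.revPerm_apply, Fin.rev_rev]
    exact if_congr (by rw [Fin.lt_def, Fin.val_rev]; omega) rfl rfl
  have hleft : ∑ q : Fin N, (if q < p then x q p.rev else 0) = ∑ a ∈ range p, x a (N - 1 - p) := by
    rw [← sum_univ_ite_lt p.isLt.le, Fin.val_rev, Nat.sub_sub, add_comm 1]
    rfl
  rw [← hright, ← hleft, ← sum_add_distrib]
  refine sum_congr rfl fun q _ => ?_
  rw [arcWeight]
  split_ifs with hpq hqp
  · exact absurd hpq hqp.asymm
  · rw [add_zero]
  · rw [zero_add]
  · rfl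

lemma isArcFilling_iff : IsArcFilling N x ↔
    (∀ i j, N ≤ i + j + 1 → x i j = 0) ∧ ∀ p : Fin N, ∑ q, arcWeight x p q = 1 := by
  simp only [sum_arcWeight]
  exact ⟨fun h => ⟨h.zero, fun p => h.one p p.isLt⟩, fun h => ⟨h.1, fun p hp => h.2 ⟨p, hp⟩⟩⟩

lemma filling_ext {y : ℕ → ℕ → ℕ} (hx : ∀ i j, N ≤ i + j + 1 → x i j = 0)
    (hy : ∀ i j, N ≤ i + j + 1 → y i j = 0)
    (h : ∀ p q : Fin N, p < q → x p q.rev = y p q.rev) : x = y := by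
  funext i j
  by_cases hij : N ≤ i + j + 1
  · rw [hx i j hij, hy i j hij]
  · have hcell := h ⟨i, by omega⟩ (Fin.rev ⟨j, by omega⟩) (by
      rw [Fin.lt_def, Fin.val_rev]
      dsimp only
      omega)
    rwa [Fin.rev_rev] at hcell

lemma IsArcFilling.exists_partner (hx : IsArcFilling N x) (p : Fin N) :
    ∃ q, arcWeight x p q = 1 ∧ ∀ r ≠ q, arcWeight x p r = 0 := by
  have hsum := (isArcFilling_iff.1 hx).2 p
  obtain ⟨q, -, hq⟩ := exists_ne_zero_of_sum_ne_zero (hsum.trans_ne one_ne_zero)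
  have hsplit := add_sum_erase univ (arcWeight x p) (mem_univ q)
  refine ⟨q, by omega, fun r hr => ?_⟩
  have := single_le_sum_of_canonicallyOrdered (f := arcWeight x p)
    (mem_erase.2 ⟨hr, mem_univ r⟩)
  omega

end ArcWeight

section Matching

variable {n : ℕ} {M M' : SetPartition n}

/-- The filling of the staircase recording the arcs of `M`, in the convention of `IsArcFilling`. -/
noncomputable def arcFilling (M : SetPartition n) (i j : ℕ) : ℕ :=
  open Classical in if ∃ p q, IsArc M p q ∧ p.val = i ∧ q.rev.val = j then 1 else 0

lemma arcFilling_ne_zero_iff {i j : ℕ} : arcFilling M i j ≠ 0 ↔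
    ∃ p q, IsArc M p q ∧ p.val = i ∧ q.rev.val = j := by
  rw [arcFilling]
  split_ifs with h
  · exact iff_of_true one_ne_zero h
  · exact iff_of_false (not_not_intro rfl) h

lemma arcFilling_le_one (M : SetPartition n) (i j : ℕ) : arcFilling M i j ≤ 1 := by
  rw [arcFilling]
  split_ifs <;> omega

lemma arcFilling_rev_ne_zero_iff {p q : Fin (2 * n)} :
    arcFilling M p q.rev ≠ 0 ↔ IsArc M p q := by
  rw [arcFilling_ne_zero_iff]
  constructor
  · rintro ⟨p', q', h, hp, hq⟩
    obtain rfl := Fin.ext hp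
    obtain rfl := Fin.rev_injective (Fin.ext hq)
    exact h
  · exact fun h => ⟨p, q, h, rfl, rfl⟩

lemma arcFilling_eq_zero (M : SetPartition n) {i j : ℕ} (h : 2 * n ≤ i + j + 1) :
    arcFilling M i j = 0 := by
  by_contra hne
  obtain ⟨p, q, ⟨hpq, -⟩, rfl, rfl⟩ := arcFilling_ne_zero_iff.1 hne
  rw [Fin.lt_def] at hpq
  rw [Fin.val_rev] at h
  omega

lemma arcWeight_arcFilling_ne_zero_iff {p q : Fin (2 * n)} :
    arcWeight (arcFilling M) p q ≠ 0 ↔ p ≠ q ∧ {p, q} ∈ M.parts := by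
  wlog hpq : p < q generalizing p q
  · rcases (not_lt.1 hpq).eq_or_lt with rfl | hqp
    · simp only [arcWeight_self, ne_eq, not_true_eq_false, false_and]
    · rw [arcWeight_comm, this hqp, ne_comm, pair_comm]
  · rw [arcWeight_of_lt _ hpq, arcFilling_rev_ne_zero_iff, IsArc]
    exact and_congr_left' (iff_of_true hpq hpq.ne)

lemma arcWeight_arcFilling_le_one (M : SetPartition n) (p q : Fin (2 * n)) :
    arcWeight (arcFilling M) p q ≤ 1 := by
  rw [arcWeight]
  split_ifs
  exacts [arcFilling_le_one M _ _, arcFilling_le_one M _ _, zero_le_one]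

lemma eq_of_pair_mem_parts {p q r : Fin (2 * n)} (hq : {p, q} ∈ M.parts) (hr : {p, r} ∈ M.parts)
    (hpr : p ≠ r) : r = q := by
  have hmem : r ∈ ({p, q} : Finset _) := by
    rw [M.eq_of_mem_parts hq hr (mem_insert_self p _) (mem_insert_self p _)]
    exact mem_insert_of_mem (mem_singleton_self r)
  exact (mem_insert.1 hmem).resolve_left hpr.symm |> mem_singleton.1

namespace IsMatching

lemma exists_partner (hM : IsMatching M) (p : Fin (2 * n)) : ∃ q, p ≠ q ∧ {p, q} ∈ M.parts := by
  obtain ⟨t, ht, hp⟩ := M.exists_mem (mem_univ p)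
  obtain ⟨a, b, hab, rfl⟩ := card_eq_two.1 (hM t ht)
  rcases mem_insert.1 hp with rfl | hb
  · exact ⟨b, hab, ht⟩
  · obtain rfl := mem_singleton.1 hb
    exact ⟨a, hab.symm, by rwa [pair_comm]⟩

lemma isArcFilling (hM : IsMatching M) : IsArcFilling (2 * n) (arcFilling M) := by
  refine isArcFilling_iff.2 ⟨fun _ _ => arcFilling_eq_zero M, fun p => ?_⟩
  obtain ⟨q, hpq, hq⟩ := hM.exists_partner p
  rw [sum_eq_single q]
  · have := arcWeight_arcFilling_ne_zero_iff.2 ⟨hpq, hq⟩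
    have := arcWeight_arcFilling_le_one M p q
    omega
  · intro r _ hrq
    by_contra hne
    obtain ⟨hpr, hr⟩ := arcWeight_arcFilling_ne_zero_iff.1 hne
    exact hrq (eq_of_pair_mem_parts hq hr hpr)
  · exact fun h => absurd (mem_univ q) h

lemma parts_subset_iff (hM : IsMatching M) : M.parts ⊆ M'.parts ↔
    ∀ p q, IsArc M p q → IsArc M' p q := by
  refine ⟨fun h p q hpq => ⟨hpq.1, h hpq.2⟩, fun h t ht => ?_⟩
  obtain ⟨p, q, hne, rfl⟩ := card_eq_two.1 (hM t ht)
  rcases hne.lt_or_gt with hpq | hqp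
  · exact (h p q ⟨hpq, ht⟩).2
  · rw [pair_comm] at ht ⊢
    exact (h q p ⟨hqp, ht⟩).2

theorem eq_of_arcFilling_eq (hM : IsMatching M) (hM' : IsMatching M')
    (h : arcFilling M = arcFilling M') : M = M' := by
  have harc (p q) : IsArc M p q ↔ IsArc M' p q := by
    rw [← arcFilling_rev_ne_zero_iff, h, arcFilling_rev_ne_zero_iff]
  exact Finpartition.ext ((hM.parts_subset_iff.2 fun p q => (harc p q).1).antisymm
    (hM'.parts_subset_iff.2 fun p q => (harc p q).2))

end IsMatching

lemma exists_isMatching_of_involutive {f : Fin (2 * n) → Fin (2 * n)} (hf : Function.Involutive f)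
    (hne : ∀ p, f p ≠ p) :
    ∃ M : SetPartition n, IsMatching M ∧ ∀ p q, p ≠ q → ({p, q} ∈ M.parts ↔ q = f p) := by
  have hblock {p r} (hp : p ∈ ({r, f r} : Finset _)) : ({r, f r} : Finset _) = {p, f p} := by
    rcases mem_insert.1 hp with rfl | hp
    · rfl
    · rw [mem_singleton.1 hp, hf, pair_comm]
  let M : SetPartition n := Finpartition.ofExistsUnique (univ.image fun p => {p, f p})
    (fun _ _ => subset_univ _)
    (fun p _ => ⟨{p, f p}, ⟨mem_image_of_mem _ (mem_univ p), mem_insert_self _ _⟩, by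
      rintro t ⟨ht, hp⟩
      obtain ⟨r, -, rfl⟩ := mem_image.1 ht
      exact hblock hp⟩)
    (fun h => by
      obtain ⟨p, -, hp⟩ := mem_image.1 h
      exact insert_ne_empty _ _ hp)
  have hparts : M.parts = univ.image fun p => {p, f p} := rfl
  refine ⟨M, fun t ht => ?_, fun p q hpq => ⟨fun h => ?_, ?_⟩⟩
  · obtain ⟨p, -, rfl⟩ := mem_image.1 ht
    exact card_pair (hne p).symm
  · exact eq_of_pair_mem_parts (hparts ▸ mem_image_of_mem _ (mem_univ p)) h hpq
  · rintro rfl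
    exact hparts ▸ mem_image_of_mem _ (mem_univ p)

theorem IsArcFilling.exists_isMatching {x : ℕ → ℕ → ℕ} (hx : IsArcFilling (2 * n) x) :
    ∃ M : SetPartition n, IsMatching M ∧ arcFilling M = x := by
  choose f hone hzero using hx.exists_partner
  have hpartner {p q} : arcWeight x p q ≠ 0 ↔ q = f p :=
    ⟨fun h => by_contra fun hq => h (hzero p q hq), fun h => by rw [h, hone]; exact one_ne_zero⟩
  have hf : Function.Involutive f := fun p => by
    rw [eq_comm, ← hpartner, arcWeight_comm, hone]
    exact one_ne_zero
  have hne (p) : f p ≠ p := fun h => by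
    have := hone p
    rw [h, arcWeight_self] at this
    omega
  obtain ⟨M, hM, hparts⟩ := exists_isMatching_of_involutive hf hne
  refine ⟨M, hM, filling_ext (fun _ _ => arcFilling_eq_zero M) hx.zero fun p q hpq => ?_⟩
  rw [← arcWeight_of_lt (arcFilling M) hpq, ← arcWeight_of_lt x hpq]
  by_cases hq : q = f p
  · have := arcWeight_arcFilling_ne_zero_iff.2 ⟨hpq.ne, (hparts p q hpq.ne).2 hq⟩
    have := arcWeight_arcFilling_le_one M p q
    rw [hq, hone] at *
    omega
  · rw [hzero p q hq]
    by_contra h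
    exact hq ((hparts p q hpq.ne).1 (arcWeight_arcFilling_ne_zero_iff.1 h).2)

lemma isBilaterallySymmetric_iff_forall_image_mem : IsBilaterallySymmetric M ↔
    ∀ t ∈ M.parts, t.image Fin.rev ∈ M.parts := by
  have hinv (t : Finset (Fin (2 * n))) : (t.image Fin.rev).image Fin.rev = t := by
    rw [image_image, Fin.rev_involutive.comp_self, image_id]
  refine ⟨fun h t ht => h ▸ mem_image_of_mem _ ht, fun h => Subset.antisymm ?_ fun t ht => ?_⟩
  · exact image_subset_iff.2 h
  · exact mem_image.2 ⟨_, h t ht, hinv t⟩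

lemma IsMatching.isBilaterallySymmetric_iff_isArc (hM : IsMatching M) :
    IsBilaterallySymmetric M ↔ ∀ p q, IsArc M p q → IsArc M q.rev p.rev := by
  have himage (p q : Fin (2 * n)) : ({p, q} : Finset _).image Fin.rev = {q.rev, p.rev} := by
    rw [image_insert, image_singleton, pair_comm]
  rw [isBilaterallySymmetric_iff_forall_image_mem]
  refine ⟨fun h p q hpq => ⟨Fin.rev_lt_rev.2 hpq.1, himage p q ▸ h _ hpq.2⟩, fun h t ht => ?_⟩
  obtain ⟨p, q, hne, rfl⟩ := card_eq_two.1 (hM t ht)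
  wlog hpq : p < q generalizing p q
  · rw [pair_comm] at ht ⊢
    exact this q p hne.symm ht (hne.lt_or_gt.resolve_left hpq)
  · exact himage p q ▸ (h p q ⟨hpq, ht⟩).2

theorem IsMatching.isBilaterallySymmetric_iff (hM : IsMatching M) :
    IsBilaterallySymmetric M ↔ Function.swap (arcFilling M) = arcFilling M := by
  rw [hM.isBilaterallySymmetric_iff_isArc]
  constructor
  · intro h
    have hswap (i j) (hij : arcFilling M i j ≠ 0) : arcFilling M j i ≠ 0 := by
      obtain ⟨p, q, hpq, rfl, rfl⟩ := arcFilling_ne_zero_iff.1 hij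
      exact arcFilling_ne_zero_iff.2 ⟨_, _, h p q hpq, rfl, by rw [Fin.rev_rev]⟩
    funext i j
    have := hswap i j
    have := hswap j i
    have := arcFilling_le_one M i j
    have := arcFilling_le_one M j i
    rw [Function.swap]
    omega
  · intro h p q hpq
    rw [← arcFilling_rev_ne_zero_iff, Fin.rev_rev, ← h]
    exact arcFilling_rev_ne_zero_iff.2 hpq

lemma forall_lt_iff_exists_split {N d : ℕ} {a b : Fin (d + 1) → Fin N}
    (ha : StrictMono a) :
    (∀ r s, a r < b s) ↔ ∃ p ≤ N, ∀ r, (a r).val < p ∧ (b r).rev.val < N - p := by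
  simp only [Fin.lt_def, Fin.val_rev]
  refine ⟨fun h => ⟨a (Fin.last d) + 1, (a _).isLt, fun r => ?_⟩, fun ⟨p, hp, h⟩ r s => ?_⟩
  · have := h (Fin.last d) r
    have := Fin.le_def.1 (ha.monotone (Fin.le_last r))
    omega
  · have := (h r).1
    have := (h s).2
    omega

lemma exists_isArc_of_arcFilling_ne_zero {k : ℕ} {a b : Fin k → ℕ}
    (h : ∀ r, arcFilling M (a r) (b r) ≠ 0) :
    ∃ p q : Fin k → Fin (2 * n), a = (fun r => (p r).val) ∧ b = (fun r => (q r).rev.val) ∧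
      ∀ r, IsArc M (p r) (q r) := by
  choose p q harc hp hq using fun r => arcFilling_ne_zero_iff.1 (h r)
  exact ⟨p, q, funext fun r => (hp r).symm, funext fun r => (hq r).symm, harc⟩

theorem hasCrossing_iff (d : ℕ) : HasCrossing (d + 1) M ↔
    ∃ p ≤ 2 * n, HasAntichain (arcFilling M) (d + 1) p (2 * n - p) := by
  constructor
  · rintro ⟨a, b, ha, hb, hab, harc⟩
    obtain ⟨p, hp, hsplit⟩ := (forall_lt_iff_exists_split ha).1 hab
    exact ⟨p, hp, fun r => a r, fun r => (b r).rev, ha, fun r s hrs => Fin.rev_lt_rev.2 (hb hrs),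
      fun r => ⟨(hsplit r).1, (hsplit r).2, arcFilling_rev_ne_zero_iff.2 (harc r)⟩⟩
  · rintro ⟨p, hp, a, b, ha, hb, hab⟩
    obtain ⟨a, b, rfl, rfl, harc⟩ := exists_isArc_of_arcFilling_ne_zero fun r => (hab r).2.2
    exact ⟨a, b, ha, fun r s hrs => Fin.rev_lt_rev.1 (hb hrs),
      (forall_lt_iff_exists_split ha).2 ⟨p, hp, fun r => ⟨(hab r).1, (hab r).2.1⟩⟩, harc⟩

theorem hasNesting_iff (d : ℕ) : HasNesting (d + 1) M ↔
    ∃ p ≤ 2 * n, HasChain (arcFilling M) (d + 1) p (2 * n - p) := by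
  constructor
  · rintro ⟨a, b, ha, hb, hab, harc⟩
    obtain ⟨p, hp, hsplit⟩ := (forall_lt_iff_exists_split ha).1 hab
    exact ⟨p, hp, fun r => a r, fun r => (b r).rev, ha, fun r s hrs => Fin.rev_lt_rev.2 (hb hrs),
      fun r => ⟨(hsplit r).1, (hsplit r).2, arcFilling_rev_ne_zero_iff.2 (harc r)⟩⟩
  · rintro ⟨p, hp, a, b, ha, hb, hab⟩
    obtain ⟨a, b, rfl, rfl, harc⟩ := exists_isArc_of_arcFilling_ne_zero fun r => (hab r).2.2
    exact ⟨a, b, ha, fun r s hrs => Fin.rev_lt_rev.1 (hb hrs),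
      (forall_lt_iff_exists_split ha).2 ⟨p, hp, fun r => ⟨(hab r).1, (hab r).2.1⟩⟩, harc⟩

end Matching

/-! ### Palindromic paths -/

section Path

variable {α β : Type*} {R : α → α → Prop} {S : Set α}

/-- The paths `w_0, …, w_m` in `S` which start at `a` and take steps from the relation `R`. -/
def pathSet (R : α → α → Prop) (S : Set α) (m : ℕ) (a : α) : Set (Fin (m + 1) → α) :=
  {w | w 0 = a ∧ (∀ i, w i ∈ S) ∧ ∀ i : Fin m, R (w i.castSucc) (w i.succ)}

/-- The palindrome of length `2 n` with first half `v`. -/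
def mirror {n : ℕ} (v : Fin (n + 1) → α) (i : Fin (2 * n + 1)) : α :=
  v ⟨min i (2 * n - i), by omega⟩

lemma isPalindromic_mirror {n : ℕ} (v : Fin (n + 1) → α) : IsPalindromic (mirror v) := by
  funext i
  refine congrArg v (Fin.ext ?_)
  simp only [Fin.val_rev]
  omega

lemma mirror_mem_pathSet [Std.Symm R] {n : ℕ} {a : α} {v : Fin (n + 1) → α}
    (hv : v ∈ pathSet R S n a) : mirror v ∈ pathSet R S (2 * n) a := by
  obtain ⟨hstart, hmem, hstep⟩ := hv
  refine ⟨hstart ▸ congrArg v (Fin.ext ?_), fun i => hmem _, fun i => ?_⟩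
  · simp only [Fin.val_zero, zero_min]
  · unfold mirror
    by_cases hi : i.val < n
    · convert hstep ⟨i, hi⟩ using 3 <;> simp <;> omega
    · convert symm (hstep ⟨2 * n - 1 - i, by omega⟩) using 3 <;> simp <;> omega

lemma IsPalindromic.eq_mirror {n : ℕ} {w : Fin (2 * n + 1) → α} (hw : IsPalindromic w) :
    w = mirror fun i : Fin (n + 1) => w ⟨i, by omega⟩ := by
  funext i
  by_cases hi : i.val ≤ n
  · refine congrArg w (Fin.ext ?_)
    simp only
    omega
  · refine (congrFun hw i).trans (congrArg w (Fin.ext ?_))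
    simp only [Fin.val_rev]
    omega

lemma IsPalindromic.last {m : ℕ} {w : Fin (m + 1) → α} (hw : IsPalindromic w) :
    w (Fin.last m) = w 0 :=
  (congrFun hw (Fin.last m)).trans (congrArg w (Fin.rev_last m))

lemma encard_palindromic_pathSet [Std.Symm R] (n : ℕ) (a : α) :
    {w ∈ pathSet R S (2 * n) a | IsPalindromic w}.encard = (pathSet R S n a).encard := by
  refine Set.encard_congr (Set.BijOn.equiv
    (fun w (i : Fin (n + 1)) => w ⟨i, by omega⟩) ⟨?_, ?_, fun v hv => ?_⟩)
  · rintro w ⟨⟨hstart, hmem, hstep⟩, -⟩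
    exact ⟨hstart, fun i => hmem _, fun i => hstep ⟨i, by omega⟩⟩
  · rintro w ⟨-, hw⟩ w' ⟨-, hw'⟩ heq
    rw [hw.eq_mirror, hw'.eq_mirror]
    exact congrArg mirror heq
  · refine ⟨mirror v, ⟨mirror_mem_pathSet hv, isPalindromic_mirror v⟩, funext fun i => ?_⟩
    refine congrArg v (Fin.ext ?_)
    simp only
    omega

lemma encard_pathSet_congr {R' : β → β → Prop} {S' : Set β} {φ : α → β} (hφ : Set.BijOn φ S S')
    (hR : ∀ x ∈ S, ∀ y ∈ S, R x y ↔ R' (φ x) (φ y)) (m : ℕ) {a : α} (ha : a ∈ S) :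
    (pathSet R S m a).encard = (pathSet R' S' m (φ a)).encard := by
  refine Set.encard_congr (Set.BijOn.equiv (φ ∘ ·) ⟨?_, ?_, ?_⟩)
  · rintro w ⟨hstart, hmem, hstep⟩
    exact ⟨congrArg φ hstart, fun i => hφ.mapsTo (hmem i),
      fun i => (hR _ (hmem _) _ (hmem _)).1 (hstep i)⟩
  · rintro w ⟨-, hmem, -⟩ w' ⟨-, hmem', -⟩ heq
    exact funext fun i => hφ.injOn (hmem i) (hmem' i) (congrFun heq i)
  · rintro v ⟨hstart, hmem, hstep⟩
    choose w hwS hwv using fun i => hφ.surjOn (hmem i)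
    refine ⟨w, ⟨hφ.injOn (hwS 0) ha ((hwv 0).trans hstart), hwS, fun i => ?_⟩, funext hwv⟩
    rw [hR _ (hwS _) _ (hwS _), hwv, hwv]
    exact hstep i

end Path

section Tableaux

open Relation

variable {d : ℕ}

lemma symmGen_addsOne_iff {x y : Fin d → ℤ} :
    SymmGen AddsOne x y ↔ ∃ k, y = x + Pi.single k 1 ∨ y = x - Pi.single k 1 := by
  simp only [SymmGen, AddsOne, exists_or, eq_sub_iff_add_eq, eq_comm (a := x)]

lemma palindromicWalks_eq (d n : ℕ) : palindromicWalks d n =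
    {w ∈ pathSet (SymmGen AddsOne) (weylChamber d) (2 * n) (weylDelta d) | IsPalindromic w} := by
  simp only [pathSet, symmGen_addsOne_iff]
  ext w
  exact and_congr_left' ⟨fun ⟨hstart, hmem, hstep⟩ => ⟨hstart, hmem, hstep⟩,
    fun ⟨hstart, hmem, hstep⟩ => ⟨hstart, hmem, hstep⟩⟩

lemma boundedTableaux_eq (d n : ℕ) : boundedTableaux d n =
    pathSet (SymmGen AddsSquare) {μ | μ.colLen 0 ≤ d} n ⊥ := by
  ext T
  exact ⟨fun ⟨⟨_, hstart, _, hstep⟩, hheight⟩ => ⟨hstart, hheight, hstep⟩,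
    fun ⟨hstart, hheight, hstep⟩ => ⟨⟨_, hstart, rfl, hstep⟩, hheight⟩⟩

lemma palindromicTableaux_eq (d n : ℕ) : palindromicTableaux d n =
    {T ∈ pathSet (SymmGen AddsSquare) {μ | μ.colLen 0 ≤ d} (2 * n) ⊥ | IsPalindromic T} := by
  ext T
  exact ⟨fun ⟨⟨hstart, _, hstep⟩, hheight, hpal⟩ => ⟨⟨hstart, hheight, hstep⟩, hpal⟩,
    fun ⟨⟨hstart, hheight, hstep⟩, hpal⟩ =>
      ⟨⟨hstart, hpal.last.trans hstart, hstep⟩, hheight, hpal⟩⟩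

theorem encard_palindromicWalks (d n : ℕ) : (palindromicWalks d n).encard =
    (pathSet (SymmGen AddsOne) (weylChamber d) n (weylDelta d)).encard := by
  rw [palindromicWalks_eq, encard_palindromic_pathSet]

theorem encard_palindromicTableaux (d n : ℕ) :
    (palindromicTableaux d n).encard = (boundedTableaux d n).encard := by
  rw [palindromicTableaux_eq, encard_palindromic_pathSet, boundedTableaux_eq]

/-- The point `(μ_1 + d, μ_2 + d - 1, …, μ_d + 1)`, which lies in the Weyl chamber. -/
def latticePoint (d : ℕ) (μ : YoungDiagram) (i : Fin d) : ℤ := μ.rowLen i + (d - i)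

lemma latticePoint_bot (d : ℕ) : latticePoint d ⊥ = weylDelta d := by
  funext i
  rw [latticePoint, weylDelta, rowLen_bot, Pi.zero_apply, Nat.cast_zero, zero_add]

lemma latticePoint_mem_weylChamber (d : ℕ) (μ : YoungDiagram) :
    latticePoint d μ ∈ weylChamber d := by
  refine ⟨fun i j hij => ?_, fun i => ?_⟩
  · have hrow := μ.rowLen_anti i j hij.le
    rw [Fin.lt_def] at hij
    simp only [latticePoint]
    omega
  · have hi := i.isLt
    simp only [latticePoint]
    omega

lemma rowLen_eq_zero_of_le {μ : YoungDiagram} {k : ℕ} (hμ : μ.colLen 0 ≤ d) (hk : d ≤ k) :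
    μ.rowLen k = 0 :=
  rowLen_eq_zero_iff.2 (hμ.trans hk)

lemma injOn_latticePoint (d : ℕ) : Set.InjOn (latticePoint d) {μ | μ.colLen 0 ≤ d} := by
  refine fun μ hμ ν hν heq => youngDiagram_ext (funext fun k => ?_)
  by_cases hk : k < d
  · have hcoord := congrFun heq ⟨k, hk⟩
    simp only [latticePoint] at hcoord
    omega
  · rw [rowLen_eq_zero_of_le hμ (not_lt.1 hk), rowLen_eq_zero_of_le hν (not_lt.1 hk)]

lemma strictAnti_add_sub_le {x : Fin d → ℤ} (hx : StrictAnti x) {i j : Fin d} (hij : i ≤ j) :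
    x j + (j - i) ≤ x i := by
  obtain ⟨j, hj⟩ := j
  induction j with
  | zero =>
    obtain rfl : i = ⟨0, hj⟩ := Fin.le_antisymm hij (Fin.mk_le_of_le_val i.val.zero_le)
    simp
  | succ j ih =>
    rcases hij.eq_or_lt with rfl | hlt
    · simp
    have hle := ih (by omega) (Nat.lt_succ_iff.1 hlt)
    have hstep : x ⟨j + 1, hj⟩ < x ⟨j, by omega⟩ := hx (Nat.lt_succ_self j)
    push_cast at hle ⊢
    omega

lemma weylDelta_le {x : Fin d → ℤ} (hx : x ∈ weylChamber d) : weylDelta d ≤ x := by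
  intro i
  have hi := i.isLt
  have hlast := hx.2 ⟨d - 1, by omega⟩
  have hle := strictAnti_add_sub_le hx.1 (i := i) (j := ⟨d - 1, by omega⟩) (Nat.le_sub_one_of_lt hi)
  simp only at hle
  simp only [weylDelta]
  omega

lemma surjOn_latticePoint (d : ℕ) :
    Set.SurjOn (latticePoint d) {μ | μ.colLen 0 ≤ d} (weylChamber d) := by
  intro x hx
  set f : ℕ → ℕ := fun k => if h : k < d then (x ⟨k, h⟩ - (d - k)).toNat else 0 with hf
  have hfd : f d = 0 := dif_neg (lt_irrefl d)
  have hanti : Antitone f := by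
    intro a b hab
    simp only [hf]
    split_ifs with hb ha
    · have hle := strictAnti_add_sub_le hx.1 (i := ⟨a, ha⟩) (j := ⟨b, hb⟩) hab
      simp only at hle
      omega
    all_goals omega
  refine ⟨ofRowLen d f, ?_, funext fun i => ?_⟩
  · rw [Set.mem_ofPred_eq, ← rowLen_eq_zero_iff, rowLen_ofRowLen hanti hfd, hfd]
  · have hle : (d : ℤ) - i ≤ x i := weylDelta_le hx i
    rw [latticePoint, rowLen_ofRowLen hanti hfd, hf]
    simp only [i.isLt, dite_true, Fin.eta]
    omega

lemma bijOn_latticePoint (d : ℕ) :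
    Set.BijOn (latticePoint d) {μ | μ.colLen 0 ≤ d} (weylChamber d) :=
  ⟨fun μ _ => latticePoint_mem_weylChamber d μ, injOn_latticePoint d, surjOn_latticePoint d⟩

lemma addsSquare_iff_latticePoint {μ ν : YoungDiagram} (hμ : μ.colLen 0 ≤ d)
    (hν : ν.colLen 0 ≤ d) :
    AddsSquare μ ν ↔ AddsOne (latticePoint d μ) (latticePoint d ν) := by
  simp only [addsSquare_iff, addsOne_iff, latticePoint]
  constructor
  · rintro ⟨k, hk⟩
    have hkd : k < d := by
      by_contra! hdk
      simpa [rowLen_eq_zero_of_le hν hdk] using hk k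
    refine ⟨⟨k, hkd⟩, fun i => ?_⟩
    simp only [hk i, Fin.ext_iff]
    split_ifs <;> push_cast <;> ring
  · rintro ⟨k, hk⟩
    refine ⟨k, fun l => ?_⟩
    by_cases hl : l < d
    · have hcoord := hk ⟨l, hl⟩
      simp only [Fin.ext_iff] at hcoord
      split_ifs at hcoord ⊢ <;> omega
    · rw [rowLen_eq_zero_of_le hμ (not_lt.1 hl), rowLen_eq_zero_of_le hν (not_lt.1 hl),
        if_neg (by omega), add_zero]

theorem encard_boundedTableaux (d n : ℕ) : (boundedTableaux d n).encard =
    (pathSet (SymmGen AddsOne) (weylChamber d) n (weylDelta d)).encard := by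
  rw [boundedTableaux_eq, ← latticePoint_bot]
  refine encard_pathSet_congr (bijOn_latticePoint d) (fun μ hμ ν hν => ?_) n ?_
  · exact or_congr (addsSquare_iff_latticePoint hμ hν) (addsSquare_iff_latticePoint hν hμ)
  · rw [Set.mem_ofPred_eq, ← rowLen_eq_zero_iff, rowLen_bot, Pi.zero_apply]

end Tableaux

section Matching

open Relation

variable {d n : ℕ} {M M' : SetPartition n}

/-- The closed oscillating tableau of a matching, read off the boundary of its growth diagram. -/
noncomputable def tableauOfMatching (M : SetPartition n) (p : Fin (2 * n + 1)) : YoungDiagram :=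
  ofRowLen p (growthSeq (2 * n) (arcFilling M) p)

namespace IsMatching

lemma rowLen_tableauOfMatching (hM : IsMatching M) (p : Fin (2 * n + 1)) :
    (tableauOfMatching M p).rowLen = growthSeq (2 * n) (arcFilling M) p :=
  have hosc := hM.isArcFilling.isOscSeq
  have hp : p.val ≤ 2 * n := Nat.lt_succ_iff.1 p.isLt
  rowLen_ofRowLen (hosc.anti p hp) (hosc.eq_zero_of_le hp le_rfl)

lemma tableauOfMatching_mem_pathSet (hM : IsMatching M) :
    tableauOfMatching M ∈ pathSet (SymmGen AddsSquare) Set.univ (2 * n) ⊥ := by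
  have hosc := hM.isArcFilling.isOscSeq
  refine ⟨youngDiagram_ext ?_, fun _ => Set.mem_univ _, fun i => ?_⟩
  · rw [hM.rowLen_tableauOfMatching, rowLen_bot]
    exact funext hosc.start
  · rw [SymmGen, addsSquare_iff, addsSquare_iff, hM.rowLen_tableauOfMatching,
      hM.rowLen_tableauOfMatching]
    exact hosc.step i i.isLt

lemma eq_of_tableauOfMatching_eq (hM : IsMatching M) (hM' : IsMatching M')
    (h : tableauOfMatching M = tableauOfMatching M') : M = M' := by
  refine hM.eq_of_arcFilling_eq hM' (hM.isArcFilling.eq_of_growthSeq_eq hM'.isArcFilling ?_)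
  intro p hp
  have hrow := congrArg YoungDiagram.rowLen (congrFun h ⟨p, Nat.lt_succ_iff.2 hp⟩)
  rwa [hM.rowLen_tableauOfMatching, hM'.rowLen_tableauOfMatching] at hrow

lemma isBilaterallySymmetric_iff_isPalindromic (hM : IsMatching M) :
    IsBilaterallySymmetric M ↔ IsPalindromic (tableauOfMatching M) := by
  rw [hM.isBilaterallySymmetric_iff, hM.isArcFilling.swap_eq_self_iff]
  have hrev (p : Fin (2 * n + 1)) : p.rev.val = 2 * n - p := by rw [Fin.val_rev]; omega
  constructor
  · refine fun h => funext fun p => youngDiagram_ext ?_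
    rw [reversal, hM.rowLen_tableauOfMatching, hM.rowLen_tableauOfMatching, hrev]
    exact h p (Nat.lt_succ_iff.1 p.isLt)
  · intro h p hp
    have hrow := congrArg YoungDiagram.rowLen (congrFun h ⟨p, Nat.lt_succ_iff.2 hp⟩)
    rwa [reversal, hM.rowLen_tableauOfMatching, hM.rowLen_tableauOfMatching, hrev] at hrow

lemma not_hasCrossing_iff (hM : IsMatching M) :
    ¬ HasCrossing (d + 1) M ↔ ∀ p, tableauOfMatching M p ∈ {μ | μ.colLen 0 ≤ d} := by
  have hp := hM.isArcFilling.isPartialPerm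
  simp only [hasCrossing_iff, ← hp.growthRow_ne_zero_iff, Set.mem_ofPred_eq, ← rowLen_eq_zero_iff,
    hM.rowLen_tableauOfMatching, growthSeq, Fin.forall_iff, Nat.lt_succ_iff]
  push Not
  rfl

lemma not_hasNesting_iff (hM : IsMatching M) :
    ¬ HasNesting (d + 1) M ↔ ∀ p, tableauOfMatching M p ∈ {μ | μ.rowLen 0 ≤ d} := by
  have hp := hM.isArcFilling.isPartialPerm
  simp only [hasNesting_iff, ← hp.le_chainLen_iff, Set.mem_ofPred_eq,
    hM.rowLen_tableauOfMatching, Fin.forall_iff, Nat.lt_succ_iff]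
  push Not
  exact forall₂_congr fun p _ => Nat.lt_succ_iff

end IsMatching

lemma isOscSeq_of_mem_pathSet {N : ℕ} {S : Set YoungDiagram} {T : Fin (N + 1) → YoungDiagram}
    (hT : T ∈ pathSet (SymmGen AddsSquare) S N ⊥) (hlast : T (Fin.last N) = ⊥) :
    IsOscSeq N fun p => (T (Fin.ofNat (N + 1) p)).rowLen := by
  obtain ⟨hstart, -, hstep⟩ := hT
  have hval {p : ℕ} (hp : p < N + 1) : Fin.ofNat (N + 1) p = ⟨p, hp⟩ :=
    Fin.ext (Nat.mod_eq_of_lt hp)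
  refine ⟨fun k => ?_, fun k => ?_, fun p _ => (T _).rowLen_anti, fun p hp => ?_⟩
  · rw [hval N.succ_pos, Fin.mk_zero', hstart, rowLen_bot, Pi.zero_apply]
  · rw [hval N.lt_succ_self, ← Fin.last, hlast, rowLen_bot, Pi.zero_apply]
  · rw [hval (hp.trans N.lt_succ_self), hval (Nat.succ_lt_succ hp), ← addsSquare_iff,
      ← addsSquare_iff]
    exact hstep ⟨p, hp⟩

lemma exists_tableauOfMatching_eq {S : Set YoungDiagram} {T : Fin (2 * n + 1) → YoungDiagram}
    (hT : T ∈ pathSet (SymmGen AddsSquare) S (2 * n) ⊥) (hlast : T (Fin.last _) = ⊥) :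
    ∃ M : SetPartition n, IsMatching M ∧ tableauOfMatching M = T := by
  obtain ⟨x, hx, hxT⟩ := (isOscSeq_of_mem_pathSet hT hlast).exists_isArcFilling
  obtain ⟨M, hM, rfl⟩ := hx.exists_isMatching
  refine ⟨M, hM, funext fun p => youngDiagram_ext ?_⟩
  rw [hM.rowLen_tableauOfMatching, hxT p (Nat.lt_succ_iff.1 p.isLt)]
  exact congrArg (fun q => (T q).rowLen) (Fin.ext (Nat.mod_eq_of_lt p.isLt))

lemma bijOn_tableauOfMatching (n : ℕ) (S : Set YoungDiagram) :
    Set.BijOn tableauOfMatching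
      {M : SetPartition n | IsMatching M ∧ IsBilaterallySymmetric M ∧
        ∀ p, tableauOfMatching M p ∈ S}
      {T ∈ pathSet (SymmGen AddsSquare) S (2 * n) ⊥ | IsPalindromic T} := by
  refine ⟨?_, ?_, ?_⟩
  · rintro M ⟨hM, hsymm, hS⟩
    obtain ⟨hstart, -, hstep⟩ := hM.tableauOfMatching_mem_pathSet
    exact ⟨⟨hstart, hS, hstep⟩, hM.isBilaterallySymmetric_iff_isPalindromic.1 hsymm⟩
  · exact fun M hM M' hM' h => hM.1.eq_of_tableauOfMatching_eq hM'.1 h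
  · rintro T ⟨hT, hpal⟩
    obtain ⟨M, hM, rfl⟩ := exists_tableauOfMatching_eq hT (hpal.last.trans hT.1)
    exact ⟨M, ⟨hM, hM.isBilaterallySymmetric_iff_isPalindromic.2 hpal, hT.2.1⟩, rfl⟩

lemma encard_isBilaterallySymmetric (n : ℕ) (S : Set YoungDiagram) :
    {M : SetPartition n | IsMatching M ∧ IsBilaterallySymmetric M ∧
      ∀ p, tableauOfMatching M p ∈ S}.encard =
    (pathSet (SymmGen AddsSquare) S n ⊥).encard := by
  rw [Set.encard_congr (bijOn_tableauOfMatching n S).equiv, encard_palindromic_pathSet]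

theorem encard_symmetricNoncrossing (d n : ℕ) :
    (symmetricNoncrossing d n).encard = (boundedTableaux d n).encard := by
  rw [boundedTableaux_eq, ← encard_isBilaterallySymmetric]
  refine congrArg Set.encard (Set.ext fun M => ?_)
  exact and_congr_right fun hM => and_congr_right fun _ => hM.not_hasCrossing_iff

lemma bijOn_transpose (d : ℕ) :
    Set.BijOn YoungDiagram.transpose {μ | μ.colLen 0 ≤ d} {μ | μ.rowLen 0 ≤ d} := by
  refine ⟨fun μ hμ => ?_, fun μ _ ν _ h => YoungDiagram.transpose_eq_iff.1 h, fun μ hμ =>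
    ⟨μ.transpose, ?_, μ.transpose_transpose⟩⟩
  · rwa [Set.mem_ofPred_eq, YoungDiagram.rowLen_transpose]
  · rwa [Set.mem_ofPred_eq, YoungDiagram.colLen_transpose]

lemma addsSquare_transpose_iff {μ ν : YoungDiagram} :
    AddsSquare μ.transpose ν.transpose ↔ AddsSquare μ ν :=
  ⟨fun h => by simpa only [YoungDiagram.transpose_transpose] using h.transpose,
    AddsSquare.transpose⟩

theorem encard_symmetricNonnesting (d n : ℕ) :
    (symmetricNonnesting d n).encard = (boundedTableaux d n).encard := by
  rw [boundedTableaux_eq, encard_pathSet_congr (R := SymmGen AddsSquare)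
    (R' := SymmGen AddsSquare) (bijOn_transpose d)
    (fun _ _ _ _ => or_congr addsSquare_transpose_iff.symm addsSquare_transpose_iff.symm) n
    (by rw [Set.mem_ofPred_eq, ← rowLen_eq_zero_iff, rowLen_bot, Pi.zero_apply]),
    transpose_bot]
  refine (congrArg Set.encard (Set.ext fun M => ?_)).trans
    (encard_isBilaterallySymmetric n {μ | μ.rowLen 0 ≤ d})
  exact and_congr_right fun hM => and_congr_right fun _ => hM.not_hasNesting_iff

end Matching

/-! ### Littlewood's identity -/

section PairProd

variable {σ R : Type*} [LinearOrder σ]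

/-- The product of `f i j` over all pairs `i < j` in `S`. -/
def pairProd [CommMonoid R] (S : Finset σ) (f : σ → σ → R) : R :=
  ∏ i ∈ S, ∏ j ∈ S with i < j, f i j

section CommMonoid

variable [CommMonoid R]

lemma pairProd_univ [Fintype σ] [LocallyFiniteOrderTop σ] (f : σ → σ → R) :
    pairProd univ f = ∏ i, ∏ j ∈ Ioi i, f i j := by
  simp only [pairProd, filter_lt_eq_Ioi]

lemma map_pairProd {R' F : Type*} [CommMonoid R'] [FunLike F R R'] [MonoidHomClass F R R']
    (φ : F) (S : Finset σ) (f : σ → σ → R) :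
    φ (pairProd S f) = pairProd S fun i j => φ (f i j) := by
  simp only [pairProd, map_prod]

lemma pairProd_erase {S : Finset σ} {i : σ} (hi : i ∈ S) (f : σ → σ → R) :
    pairProd S f =
      (∏ k ∈ S.erase i, if k < i then f k i else f i k) * pairProd (S.erase i) f := by
  have hrow (a : σ) : ∏ b ∈ S with a < b, f a b =
      (if a < i then f a i else 1) * ∏ b ∈ S.erase i with a < b, f a b := by
    rw [prod_filter, ← mul_prod_erase S _ hi, prod_filter]
  have hlast : ∏ b ∈ S.erase i with i < b, f i b =
      ∏ k ∈ S.erase i, if i < k then f i k else 1 := prod_filter _ _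
  simp only [pairProd, hrow, prod_mul_distrib]
  rw [← mul_prod_erase S _ hi, ← mul_prod_erase S _ hi, if_neg (lt_irrefl i), one_mul, hlast,
    ← mul_assoc, ← prod_mul_distrib]
  congr 1
  refine prod_congr rfl fun k hk => ?_
  rcases lt_or_gt_of_ne (ne_of_mem_erase hk) with hki | hik
  · simp only [hki, hki.asymm, if_true, if_false, mul_one]
  · simp only [hik, hik.asymm, if_true, if_false, one_mul]

end CommMonoid

lemma pairProd_erase_of_neg [CommRing R] {S : Finset σ} {i : σ} (hi : i ∈ S) {f : σ → σ → R}
    (hf : ∀ k, f k i = -f i k) :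
    pairProd S f =
      (-1) ^ #{k ∈ S | k < i} * (∏ k ∈ S.erase i, f i k) * pairProd (S.erase i) f := by
  have hnot : i ∉ {k ∈ S | k < i} := fun h => lt_irrefl i (mem_filter.1 h).2
  have hfilter : {k ∈ S.erase i | k < i} = {k ∈ S | k < i} := by
    rw [filter_erase, erase_eq_of_notMem hnot]
  rw [pairProd_erase hi, ← hfilter, ← prod_const, prod_filter, ← prod_mul_distrib]
  congr 1
  refine prod_congr rfl fun k _ => ?_
  split_ifs
  · rw [hf, neg_one_mul]
  · rw [one_mul]

end PairProd

section Lagrange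

open Polynomial

variable {K : Type*} [Field K]

lemma sum_eval_div_prod_sub_eq_zero [DecidableEq K] {S : Finset K} {a b : K} (hab : a ≠ b)
    (ha : a ∉ S) (hb : b ∉ S) {P : K[X]} (hP : P.natDegree ≤ #S) :
    P.eval a / ((a - b) * ∏ y ∈ S, (a - y)) + P.eval b / ((b - a) * ∏ y ∈ S, (b - y)) +
      ∑ x ∈ S, P.eval x / ((x - a) * (x - b) * ∏ y ∈ S.erase x, (x - y)) = 0 := by
  have ha' : a ∉ insert b S := by rw [mem_insert, not_or]; exact ⟨hab, ha⟩
  have hcard : #(insert a (insert b S)) = #S + 2 := by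
    rw [card_insert_of_notMem ha', card_insert_of_notMem hb]
  have hsum := Lagrange.coeff_eq_sum (s := insert a (insert b S)) (v := (id : K → K))
    Function.injective_id.injOn (P := P)
    (degree_le_natDegree.trans_lt (by rw [hcard]; exact_mod_cast by omega))
  rw [hcard, coeff_eq_zero_of_natDegree_lt (by omega), sum_insert ha', sum_insert hb,
    erase_insert ha', prod_insert hb, Finset.insert_comm, erase_insert, prod_insert ha,
    ← add_assoc] at hsum
  · rw [hsum]
    congr 1
    refine sum_congr rfl fun x hx => ?_
    have hxa : x ≠ a := ne_of_mem_of_not_mem hx ha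
    have hxb : x ≠ b := ne_of_mem_of_not_mem hx hb
    rw [erase_insert_of_ne hxb.symm, erase_insert_of_ne hxa.symm, prod_insert, prod_insert,
      mul_assoc, mul_left_comm]
    · rfl
    · exact fun h => ha (mem_of_mem_erase h)
    · rw [mem_insert, not_or]
      exact ⟨hab.symm, fun h => hb (mem_of_mem_erase h)⟩
  · rw [mem_insert, not_or]
    exact ⟨hab.symm, hb⟩

lemma prod_one_add_div_prod {S : Finset K} (hzero : 0 ∉ S) (hneg : -1 ∉ S) :
    (∏ y ∈ S, (1 + y)) / (-1 * ∏ y ∈ S, (-1 - y)) = -(∏ y ∈ S, y) / ∏ y ∈ S, (-y) := by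
  have hpos : ∏ y ∈ S, (1 + y) ≠ 0 := prod_ne_zero_iff.2 fun y hy h =>
    ne_of_mem_of_not_mem hy hneg (eq_neg_of_add_eq_zero_right h)
  have hprod : ∏ y ∈ S, y ≠ 0 := prod_ne_zero_iff.2 fun y hy => ne_of_mem_of_not_mem hy hzero
  have hneg_prod : ∏ y ∈ S, (-1 - y) = (-1) ^ #S * ∏ y ∈ S, (1 + y) := by
    rw [← prod_neg]
    exact prod_congr rfl fun y _ => by ring
  rw [hneg_prod, prod_neg]
  field_simp

lemma prod_one_sub_mul_div_prod [DecidableEq K] {S : Finset K} (hzero : 0 ∉ S) (hneg : -1 ∉ S)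
    {x : K} (hx : x ∈ S) :
    (∏ y ∈ S, (1 - x * y)) / (x * (x + 1) * ∏ y ∈ S.erase x, (x - y)) =
      -((1 - x) * ∏ y ∈ S.erase x, y * (1 - x * y) / (y - x)) / ∏ y ∈ S, (-y) := by
  have hx_zero : x ≠ 0 := ne_of_mem_of_not_mem hx hzero
  have hx_add : x + 1 ≠ 0 := fun h => ne_of_mem_of_not_mem hx hneg (eq_neg_of_add_eq_zero_left h)
  have hprod : ∏ y ∈ S.erase x, (-y) ≠ 0 := prod_ne_zero_iff.2 fun y hy =>
    neg_ne_zero.2 (ne_of_mem_of_not_mem (mem_of_mem_erase hy) hzero)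
  have hsub : ∏ y ∈ S.erase x, (x - y) ≠ 0 := prod_ne_zero_iff.2 fun y hy =>
    sub_ne_zero.2 (ne_of_mem_erase hy).symm
  have hsplit : ∏ y ∈ S.erase x, y * (1 - x * y) / (y - x) =
      (∏ y ∈ S.erase x, (-y)) * (∏ y ∈ S.erase x, (1 - x * y)) / ∏ y ∈ S.erase x, (x - y) := by
    rw [← prod_mul_distrib, ← prod_div_distrib]
    refine prod_congr rfl fun y _ => ?_
    rw [neg_mul, ← neg_sub y x, neg_div_neg_eq]
  rw [hsplit, ← mul_prod_erase S _ hx, ← mul_prod_erase S (fun y => -y) hx]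
  field_simp
  ring

/-- Lagrange interpolation of `∏ (1 - X y)` at the points of `S` and at `0` and `-1`. -/
lemma sum_prod_lagrange [DecidableEq K] {S : Finset K} (hzero : 0 ∉ S) (hneg : -1 ∉ S) :
    ∑ x ∈ S, (1 - x) * ∏ y ∈ S.erase x, y * (1 - x * y) / (y - x) = 1 - ∏ y ∈ S, y := by
  set P : K[X] := ∏ y ∈ S, (1 - C y * X) with hP
  have hdeg : P.natDegree ≤ #S := by
    refine (natDegree_prod_le _ _).trans ?_
    rw [card_eq_sum_ones]
    refine sum_le_sum fun y _ => ?_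
    compute_degree
  have heval (x : K) : P.eval x = ∏ y ∈ S, (1 - x * y) := by
    simp only [hP, eval_prod, eval_sub, eval_one, eval_mul, eval_C, eval_X, mul_comm]
  have hprod : ∏ y ∈ S, (-y) ≠ 0 := prod_ne_zero_iff.2 fun y hy =>
    neg_ne_zero.2 (ne_of_mem_of_not_mem hy hzero)
  have hsum := sum_eval_div_prod_sub_eq_zero (neg_ne_zero.2 one_ne_zero).symm hzero hneg hdeg
  simp only [heval, zero_mul, sub_zero, prod_const_one, zero_sub, zero_add, one_mul, neg_one_mul,
    sub_neg_eq_add] at hsum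
  rw [← neg_one_mul (∏ y ∈ S, (-1 - y)), prod_one_add_div_prod hzero hneg,
    sum_congr rfl fun x hx => prod_one_sub_mul_div_prod hzero hneg hx, ← sum_div, ← add_div,
    ← add_div, div_eq_zero_iff, or_iff_left hprod, sum_neg_distrib] at hsum
  linear_combination -hsum

end Lagrange

section VandermondeErase

variable {σ R : Type*} [LinearOrder σ] [CommRing R]

lemma sum_vandermonde_erase_field {K : Type*} [Field K] {z : σ → K} (hz : Function.Injective z)
    (hzero : ∀ i, z i ≠ 0) (hneg : ∀ i, z i ≠ -1) (S : Finset σ) :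
    ∑ i ∈ S, (-1) ^ #{k ∈ S | k < i} * (1 - z i) * (∏ k ∈ S.erase i, z k * (1 - z i * z k)) *
      pairProd (S.erase i) (fun i j => z j - z i) =
    (1 - ∏ i ∈ S, z i) * pairProd S fun i j => z j - z i := by
  classical
  have hsum := sum_prod_lagrange (S := S.image z) (by simp [hzero]) (by simp [hneg])
  rw [sum_image hz.injOn, prod_image hz.injOn] at hsum
  rw [← hsum, sum_mul]
  refine sum_congr rfl fun i hi => ?_
  have hne : ∏ k ∈ S.erase i, (z k - z i) ≠ 0 := prod_ne_zero_iff.2 fun k hk =>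
    sub_ne_zero.2 (hz.ne (ne_of_mem_erase hk))
  rw [← image_erase hz, prod_image hz.injOn,
    pairProd_erase_of_neg hi fun k => (neg_sub (z k) (z i)).symm, prod_div_distrib]
  field_simp

lemma sum_vandermonde_erase [IsDomain R] {z : σ → R} (hz : Function.Injective z)
    (hzero : ∀ i, z i ≠ 0) (hneg : ∀ i, z i ≠ -1) (S : Finset σ) :
    ∑ i ∈ S, (-1) ^ #{k ∈ S | k < i} * (1 - z i) * (∏ k ∈ S.erase i, z k * (1 - z i * z k)) *
      pairProd (S.erase i) (fun i j => z j - z i) =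
    (1 - ∏ i ∈ S, z i) * pairProd S fun i j => z j - z i := by
  have hinj : Function.Injective (algebraMap R (FractionRing R)) :=
    IsFractionRing.injective R (FractionRing R)
  apply hinj
  simp only [map_sum, map_mul, map_prod, map_pairProd, map_sub, map_one, map_pow, map_neg]
  refine sum_vandermonde_erase_field (hinj.comp hz) (fun i => ?_) (fun i => ?_) S
  · rw [Function.comp_apply, ← map_zero (algebraMap R (FractionRing R))]
    exact hinj.ne (hzero i)
  · rw [Function.comp_apply, ← map_one (algebraMap R (FractionRing R)), ← map_neg]
    exact hinj.ne (hneg i)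

end VandermondeErase

section VandermondeSign

variable {σ : Type*} [LinearOrder σ]

/-- The sign of the Vandermonde product `∏ (y j - y i)` over the pairs `i < j` in `S`. -/
def vandermondeSign (S : Finset σ) (y : σ → ℤ) : ℤ :=
  pairProd S fun i j => (y j - y i).sign

lemma vandermondeSign_congr_of_sub {S : Finset σ} {x y : σ → ℤ} {c : ℤ}
    (h : ∀ i ∈ S, x i = y i - c) : vandermondeSign S x = vandermondeSign S y :=
  prod_congr rfl fun i hi => prod_congr rfl fun j hj => by
    simp only [h i hi, h j (mem_of_mem_filter j hj), sub_sub_sub_cancel_right]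

lemma vandermondeSign_erase_of_eq_zero {S : Finset σ} {i : σ} (hi : i ∈ S) {y : σ → ℤ}
    (hy : y i = 0) :
    vandermondeSign S y = (-1) ^ #{k ∈ S | k < i} * (∏ k ∈ S.erase i, (y k).sign) *
      vandermondeSign (S.erase i) y := by
  rw [vandermondeSign, pairProd_erase_of_neg hi fun k => by rw [← Int.sign_neg, neg_sub]]
  simp only [hy, sub_zero, vandermondeSign]

end VandermondeSign

section OrderSeries

open MvPowerSeries

section Nontrivial

variable {σ R : Type*} [CommRing R] [Nontrivial R]

lemma X_ne_zero (i : σ) : (X i : MvPowerSeries σ R) ≠ 0 := fun h => by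
  simpa using congrArg (coeff (Finsupp.single i 1)) h

lemma X_ne_neg_one (i : σ) : (X i : MvPowerSeries σ R) ≠ -1 := fun h => by
  simpa using congrArg constantCoeff h

lemma one_sub_prod_X_ne_zero {S : Finset σ} (hS : S.Nonempty) :
    (1 - ∏ k ∈ S, X k : MvPowerSeries σ R) ≠ 0 := by
  obtain ⟨i, hi⟩ := hS
  intro h
  have hconst := congrArg constantCoeff h
  rw [map_sub, map_prod, prod_eq_zero hi (constantCoeff_X i)] at hconst
  simp at hconst

end Nontrivial

variable {σ R : Type*} [LinearOrder σ] [CommRing R]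

/-- The generating function, in the variables of `S`, of the sign of the Vandermonde product of
the exponents. -/
noncomputable def orderSeries (S : Finset σ) : MvPowerSeries σ R := fun m =>
  if m.support ⊆ S then (vandermondeSign S fun i => m i : ℤ) else 0

lemma coeff_orderSeries (S : Finset σ) (m : σ →₀ ℕ) :
    coeff m (orderSeries S : MvPowerSeries σ R) =
      if m.support ⊆ S then ((vandermondeSign S fun i => m i : ℤ) : R) else 0 := rfl

lemma orderSeries_empty : (orderSeries ∅ : MvPowerSeries σ R) = 1 := by
  ext m
  simp [coeff_orderSeries, coeff_one, vandermondeSign, pairProd]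

lemma coeff_prod_X_mul_orderSeries (S : Finset σ) (m : σ →₀ ℕ) :
    coeff m ((∏ k ∈ S, X k) * orderSeries S : MvPowerSeries σ R) =
      if m.support = S then ((vandermondeSign S fun i => m i : ℤ) : R) else 0 := by
  set e : σ →₀ ℕ := ∑ k ∈ S, Finsupp.single k 1 with he
  have hmonomial : ∏ k ∈ S, (X k : MvPowerSeries σ R) = monomial e 1 := by
    simp only [X, prod_monomial, prod_const_one, he]
  have happly (i : σ) : e i = if i ∈ S then 1 else 0 := by
    simp [he, Finsupp.finsetSum_apply, Finsupp.single_apply]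
  have hle : e ≤ m ↔ S ⊆ m.support := by
    refine forall_congr' fun i => ?_
    rw [happly, Finsupp.mem_support_iff]
    grind
  have hsupport (hS : S ⊆ m.support) : (m - e).support ⊆ S ↔ m.support = S := by
    rw [subset_antisymm_iff, and_iff_left hS]
    refine forall_congr' fun i => ?_
    simp only [Finsupp.mem_support_iff, Finsupp.tsub_apply, happly]
    grind
  rw [hmonomial, coeff_monomial_mul, one_mul, coeff_orderSeries]
  by_cases hS : S ⊆ m.support
  · rw [if_pos (hle.2 hS), if_congr (hsupport hS) rfl rfl,
      vandermondeSign_congr_of_sub (y := fun i => m i) (c := 1) fun i hi => ?_]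
    have hmi : m i ≠ 0 := Finsupp.mem_support_iff.1 (hS hi)
    rw [Finsupp.tsub_apply, happly, if_pos hi]
    omega
  · rw [if_neg (mt hle.1 hS), if_neg fun h => hS h.ge]

lemma prod_sign_eq_ite {S : Finset σ} {m : σ →₀ ℕ} (h : m.support ⊆ S) :
    ∏ k ∈ S, (m k : ℤ).sign = if m.support = S then 1 else 0 := by
  split_ifs with heq
  · refine prod_eq_one fun k hk => Int.sign_eq_one_of_pos ?_
    rw [← heq, Finsupp.mem_support_iff] at hk
    omega
  · obtain ⟨k, hk, hmk⟩ := exists_of_ssubset (h.ssubset_of_ne heq)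
    refine prod_eq_zero hk ?_
    rw [Finsupp.notMem_support_iff.1 hmk, Nat.cast_zero, Int.sign_zero]

lemma one_sub_prod_mul_orderSeries (S : Finset σ) :
    (1 - ∏ k ∈ S, X k) * orderSeries S =
      ∑ i ∈ S, (-1) ^ #{k ∈ S | k < i} *
        ((∏ k ∈ S.erase i, X k) * orderSeries (S.erase i) : MvPowerSeries σ R) := by
  ext m
  have hsign (i : σ) : (-1 : MvPowerSeries σ R) ^ #{k ∈ S | k < i} =
      C ((-1) ^ #{k ∈ S | k < i}) := by simp only [map_pow, map_neg, map_one]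
  simp only [sub_mul, one_mul, map_sub, map_sum, hsign, coeff_C_mul, coeff_orderSeries,
    coeff_prod_X_mul_orderSeries]
  by_cases hss : m.support ⊂ S
  · obtain ⟨i, hi, hmi⟩ := exists_of_ssubset hss
    have hsub : m.support ⊆ S := hss.subset
    have hsub_erase : m.support ⊆ S.erase i := subset_erase.2 ⟨hsub, hmi⟩
    rw [if_pos hsub, if_neg hss.ne, sub_zero, sum_eq_single_of_mem i hi]
    · rw [vandermondeSign_erase_of_eq_zero hi (mod_cast Finsupp.notMem_support_iff.1 hmi),
        prod_sign_eq_ite hsub_erase]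
      split_ifs <;> simp
    · intro k _ hki
      rw [if_neg, mul_zero]
      exact fun h => hmi (h ▸ mem_erase.2 ⟨hki.symm, hi⟩)
  · have heq : m.support ⊆ S ↔ m.support = S :=
      ⟨fun h => by_contra fun hne => hss (h.ssubset_of_ne hne), fun h => h.subset⟩
    rw [if_congr heq rfl rfl, sub_self, eq_comm]
    refine sum_eq_zero fun i hi => ?_
    rw [if_neg, mul_zero]
    exact fun h => hss (h ▸ erase_ssubset hi)

/-- Littlewood's identity for the sum of all Schur functions. -/
theorem prod_mul_orderSeries [IsDomain R] (S : Finset σ) :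
    (∏ i ∈ S, (1 - X i)) * (pairProd S fun i j => 1 - X i * X j) * orderSeries S =
      pairProd S fun i j => (X j - X i : MvPowerSeries σ R) := by
  have : IsDomain (MvPowerSeries σ R) := NoZeroDivisors.to_isDomain _
  induction S using Finset.strongInduction with
  | H S ih =>
  rcases S.eq_empty_or_nonempty with rfl | hS
  · simp [orderSeries_empty, pairProd]
  have hterm {i : σ} (hi : i ∈ S) :
      (∏ i ∈ S, (1 - X i : MvPowerSeries σ R)) * (pairProd S fun i j => 1 - X i * X j) *
        ((∏ k ∈ S.erase i, X k) * orderSeries (S.erase i)) =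
      (1 - X i) * (∏ k ∈ S.erase i, X k * (1 - X i * X k)) *
        pairProd (S.erase i) fun i j => X j - X i := by
    have hrow : (∏ k ∈ S.erase i, if k < i then 1 - X k * X i else 1 - X i * X k) =
        ∏ k ∈ S.erase i, (1 - X i * X k : MvPowerSeries σ R) :=
      prod_congr rfl fun k _ => by rw [mul_comm (X k), ite_self]
    rw [← ih _ (erase_ssubset hi), pairProd_erase hi, hrow, ← mul_prod_erase S _ hi,
      prod_mul_distrib]
    ring
  apply mul_left_cancel₀ (one_sub_prod_X_ne_zero hS)
  rw [mul_left_comm, one_sub_prod_mul_orderSeries, mul_sum, ← sum_vandermonde_erase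
    (fun i j h => X_inj.1 h) X_ne_zero X_ne_neg_one]
  refine sum_congr rfl fun i hi => ?_
  rw [mul_left_comm, hterm hi]
  simp only [mul_assoc]

end OrderSeries

/-! ### Walks in the Weyl chamber -/

section FirstStep

variable {α ι : Type*} {R : α → α → Prop} {S : Set α} {a : α}

lemma pathSet_succ (ha : a ∈ S) {g : ι → α} (hg : ∀ y, R a y ↔ ∃ i, y = g i) (m : ℕ) :
    pathSet R S (m + 1) a =
      ⋃ i, (fun w => (Fin.cons a w : Fin (m + 2) → α)) '' pathSet R S m (g i) := by
  ext w
  simp only [Set.mem_iUnion, Set.mem_image]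
  constructor
  · rintro ⟨hstart, hmem, hstep⟩
    obtain ⟨i, hi⟩ := (hg (w 1)).1 (by rw [← hstart]; exact hstep 0)
    refine ⟨i, Fin.tail w, ⟨hi, fun j => hmem j.succ, fun j => hstep j.succ⟩, ?_⟩
    rw [← hstart]
    exact Fin.cons_self_tail w
  · rintro ⟨i, w, ⟨hstart, hmem, hstep⟩, rfl⟩
    refine ⟨Fin.cons_zero _ _, Fin.cases ha hmem, Fin.cases ?_ fun j => ?_⟩
    · rw [Fin.castSucc_zero, Fin.cons_zero, Fin.cons_succ, hstart, hg]
      exact ⟨i, rfl⟩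
    · rw [Fin.cons_succ, ← Fin.succ_castSucc, Fin.cons_succ]
      exact hstep j

lemma encard_pathSet_succ [Fintype ι] (ha : a ∈ S) {g : ι → α} (hinj : Function.Injective g)
    (hg : ∀ y, R a y ↔ ∃ i, y = g i) (m : ℕ) :
    (pathSet R S (m + 1) a).encard = ∑ i, (pathSet R S m (g i)).encard := by
  have hcons : Function.Injective fun w : Fin (m + 1) → α => (Fin.cons a w : Fin (m + 2) → α) :=
    Fin.cons_right_injective (α := fun _ => α) a
  rw [pathSet_succ ha hg, Set.encard_iUnion_of_finite, finsum_eq_sum_of_fintype]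
  · exact sum_congr rfl fun i _ => hcons.encard_image _
  · intro i j hij
    refine Set.disjoint_left.2 ?_
    rintro _ ⟨w, hw, rfl⟩ ⟨w', hw', heq⟩
    obtain rfl := hcons heq
    exact hij (hinj (hw.1.symm.trans hw'.1))

lemma pathSet_eq_empty (ha : a ∉ S) (m : ℕ) : pathSet R S m a = ∅ :=
  Set.eq_empty_of_forall_notMem fun _ hw => ha (hw.1 ▸ hw.2.1 0)

lemma encard_pathSet_zero (ha : a ∈ S) : (pathSet R S 0 a).encard = 1 := by
  refine Set.encard_eq_one.2 ⟨fun _ => a, Set.eq_singleton_iff_unique_mem.2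
    ⟨⟨rfl, fun _ => ha, fun i => i.elim0⟩, fun w hw => funext fun i => ?_⟩⟩
  rw [Subsingleton.elim (α := Fin 1) i 0, hw.1]

end FirstStep

section WalkRecursion

open Relation

variable {d : ℕ}

lemma add_single_injective (x : Fin d → ℤ) :
    Function.Injective fun s : Fin d × ℤˣ => x + Pi.single s.1 (s.2 : ℤ) := by
  rintro ⟨k, ε⟩ ⟨l, η⟩ h
  have heq : Pi.single k (ε : ℤ) = Pi.single l (η : ℤ) :=
    add_left_cancel (a := x) h
  have hk := congrFun heq k
  obtain rfl : k = l := by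
    by_contra hkl
    rw [Pi.single_eq_same, Pi.single_eq_of_ne hkl] at hk
    exact ε.ne_zero hk
  rw [Pi.single_eq_same, Pi.single_eq_same] at hk
  rw [Units.ext hk]

lemma symmGen_addsOne_iff_units {x y : Fin d → ℤ} :
    SymmGen AddsOne x y ↔ ∃ s : Fin d × ℤˣ, y = x + Pi.single s.1 (s.2 : ℤ) := by
  rw [symmGen_addsOne_iff, Prod.exists]
  refine exists_congr fun k => ⟨?_, ?_⟩
  · rintro (h | h)
    · exact ⟨1, h⟩
    · exact ⟨-1, by rw [h, Units.val_neg, Units.val_one, Pi.single_neg, sub_eq_add_neg]⟩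
  · rintro ⟨ε, h⟩
    rcases Int.units_eq_one_or ε with rfl | rfl
    · exact Or.inl h
    · exact Or.inr (by rw [h, Units.val_neg, Units.val_one, Pi.single_neg, sub_eq_add_neg])

lemma add_single_mem_weylChamber {x : Fin d → ℤ} (hx : x ∈ weylChamber d) {k : Fin d} {ε : ℤˣ}
    (hinj : Function.Injective (x + Pi.single k (ε : ℤ)))
    (hzero : ∀ i, (x + Pi.single k (ε : ℤ) : Fin d → ℤ) i ≠ 0) :
    x + Pi.single k (ε : ℤ) ∈ weylChamber d := by
  have hval (i : Fin d) : (x + Pi.single k (ε : ℤ) : Fin d → ℤ) i =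
      x i + if i = k then (ε : ℤ) else 0 := by rw [Pi.add_apply, Pi.single_apply]
  have hε : (ε : ℤ) = 1 ∨ (ε : ℤ) = -1 := by
    rcases Int.units_eq_one_or ε with rfl | rfl <;> simp
  refine ⟨fun i j hij => ?_, fun i => ?_⟩
  · have hlt := hx.1 hij
    have hne := hinj.ne hij.ne
    rw [hval, hval] at hne ⊢
    grind
  · have hpos := hx.2 i
    have hne := hzero i
    rw [hval] at hne ⊢
    grind

lemma encard_pathSet_eq_of_recursion {R : Type*} [Semiring R] {f : ℕ → (Fin d → ℤ) → R}
    (hone : ∀ x ∈ weylChamber d, f 0 x = 1)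
    (hsucc : ∀ n x, f (n + 1) x = ∑ k, (f n (x + Pi.single k 1) + f n (x - Pi.single k 1)))
    (hwall : ∀ n x, ¬ Function.Injective x → f n x = 0)
    (hzero : ∀ n x i, x i = 0 → f n x = 0) (n : ℕ) {x : Fin d → ℤ} (hx : x ∈ weylChamber d) :
    ∃ N : ℕ, (N : R) = f n x ∧ (pathSet (SymmGen AddsOne) (weylChamber d) n x).encard = N := by
  induction n generalizing x with
  | zero =>
    exact ⟨1, by rw [hone x hx, Nat.cast_one], by rw [encard_pathSet_zero hx, Nat.cast_one]⟩
  | succ n ih =>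
    have hneighbor (s : Fin d × ℤˣ) : ∃ N : ℕ, (N : R) = f n (x + Pi.single s.1 (s.2 : ℤ)) ∧
        (pathSet (SymmGen AddsOne) (weylChamber d) n (x + Pi.single s.1 (s.2 : ℤ))).encard =
          N := by
      by_cases hs : x + Pi.single s.1 (s.2 : ℤ) ∈ weylChamber d
      · exact ih hs
      · refine ⟨0, ?_, by rw [pathSet_eq_empty hs, Set.encard_empty, Nat.cast_zero]⟩
        rw [Nat.cast_zero, eq_comm]
        by_contra hne
        exact hs (add_single_mem_weylChamber hx (by_contra fun h => hne (hwall n _ h))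
          fun i h => hne (hzero n _ i h))
    choose N hN hN' using hneighbor
    refine ⟨∑ s, N s, ?_, ?_⟩
    · rw [Nat.cast_sum, hsucc, Fintype.sum_prod_type]
      refine sum_congr rfl fun k _ => ?_
      rw [UnitsInt.univ, sum_pair (by decide), hN, hN, Units.val_neg, Units.val_one,
        Pi.single_neg, ← sub_eq_add_neg]
    · rw [encard_pathSet_succ hx (add_single_injective x) fun y => symmGen_addsOne_iff_units,
        Nat.cast_sum]
      exact sum_congr rfl fun s _ => hN' s

end WalkRecursion

/-! ### Laurent polynomials -/

lemma prod_add_eq_sum_prod_piecewise {ι R : Type*} [Fintype ι] [DecidableEq ι] [CommSemiring R]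
    (f g : ι → R) : ∏ i, (f i + g i) = ∑ t : Finset ι, ∏ i, t.piecewise f g i := by
  rw [prod_add, powerset_univ]
  refine sum_congr rfl fun t _ => ?_
  rw [prod_piecewise, univ_inter]

/-- Laurent polynomials in `d` variables, as the group algebra of the lattice of exponents. -/
abbrev Laurent (R : Type*) [CommRing R] (d : ℕ) : Type _ := AddMonoidAlgebra R (Fin d → ℤ)

section Laurent

variable {R : Type*} [CommRing R] {d : ℕ}

/-- The Laurent monomial with exponent vector `y`. -/
noncomputable def laurentMono (y : Fin d → ℤ) : Laurent R d := AddMonoidAlgebra.single y 1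

lemma laurentMono_mul (x y : Fin d → ℤ) :
    (laurentMono x * laurentMono y : Laurent R d) = laurentMono (x + y) := by
  rw [laurentMono, laurentMono, AddMonoidAlgebra.single_mul_single, one_mul, laurentMono]

lemma laurentMono_zero : (laurentMono 0 : Laurent R d) = 1 := rfl

lemma prod_laurentMono {ι : Type*} (s : Finset ι) (y : ι → Fin d → ℤ) :
    (∏ i ∈ s, laurentMono (y i) : Laurent R d) = laurentMono (∑ i ∈ s, y i) := by
  simp only [laurentMono, AddMonoidAlgebra.prod_single, prod_const_one]

lemma coeff_laurentMono_mul (x : Fin d → ℤ) (g : Laurent R d) (y : Fin d → ℤ) :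
    (laurentMono x * g).coeff y = g.coeff (y - x) := by
  rw [laurentMono, AddMonoidAlgebra.coeff_single_mul_apply, one_mul, neg_add_eq_sub]

lemma laurent_hom_ext {M : Type*} [AddCommMonoid M] [Module R M] {f g : Laurent R d →ₗ[R] M}
    (h : ∀ y, f (laurentMono y) = g (laurentMono y)) : f = g :=
  AddMonoidAlgebra.lhom_ext' fun y => LinearMap.ext_ring (h y)

/-- The power `z_i ^ n` of the variable `z_i`. -/
noncomputable def laurentVar (i : Fin d) (n : ℤ) : Laurent R d := laurentMono (Pi.single i n)

lemma laurentVar_mul (i : Fin d) (m n : ℤ) :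
    (laurentVar i m * laurentVar i n : Laurent R d) = laurentVar i (m + n) := by
  rw [laurentVar, laurentVar, laurentMono_mul, laurentVar, Pi.single_add]

lemma laurentVar_zero (i : Fin d) : (laurentVar i 0 : Laurent R d) = 1 := by
  rw [laurentVar, Pi.single_zero, laurentMono_zero]

lemma laurentVar_pow (i : Fin d) (m : ℤ) (n : ℕ) :
    (laurentVar i m ^ n : Laurent R d) = laurentVar i (n * m) := by
  rw [laurentVar, laurentMono, AddMonoidAlgebra.single_pow, one_pow, laurentVar, laurentMono,
    ← Pi.single_smul, nsmul_eq_mul]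

lemma prod_laurentVar (y : Fin d → ℤ) :
    (∏ i, laurentVar i (y i) : Laurent R d) = laurentMono y := by
  simp only [laurentVar, prod_laurentMono, univ_sum_single]

lemma prod_smul_laurentVar_add (a b : Fin d → R) (x y : Fin d → ℤ) :
    ∏ i, (a i • laurentVar i (x i) + b i • laurentVar i (y i) : Laurent R d) =
      ∑ t : Finset (Fin d), (∏ i, t.piecewise a b i) • laurentMono (t.piecewise x y) := by
  rw [prod_add_eq_sum_prod_piecewise]
  refine sum_congr rfl fun t _ => ?_
  rw [← prod_laurentVar, ← prod_smul]
  exact prod_congr rfl fun i _ => by by_cases hi : i ∈ t <;> simp [hi]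

/-- The generating function of the steps `± e_k` of a lattice walk. -/
noncomputable def stepPoly (R : Type*) [CommRing R] (d : ℕ) : Laurent R d :=
  ∑ k, (laurentVar k 1 + laurentVar k (-1))

/-- The linear functional on Laurent polynomials with value `φ y` on the monomial `z ^ y`. -/
noncomputable def laurentPairing (φ : (Fin d → ℤ) → R) : Laurent R d →ₗ[R] R :=
  Finsupp.linearCombination R φ ∘ₗ (AddMonoidAlgebra.coeffLinearEquiv R).toLinearMap

@[simp] lemma laurentPairing_mono (φ : (Fin d → ℤ) → R) (y : Fin d → ℤ) :
    laurentPairing φ (laurentMono y) = φ y := by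
  simp [laurentPairing, laurentMono]

/-- The automorphism of the Laurent polynomials that permutes the variables by `σ`. -/
noncomputable def laurentPerm (σ : Equiv.Perm (Fin d)) : Laurent R d →ₐ[R] Laurent R d :=
  AddMonoidAlgebra.mapDomainAlgHom R R (LinearMap.funLeft ℤ ℤ σ.symm).toAddMonoidHom

lemma laurentPerm_mono (σ : Equiv.Perm (Fin d)) (y : Fin d → ℤ) :
    (laurentPerm σ (laurentMono y) : Laurent R d) = laurentMono (y ∘ σ.symm) :=
  AddMonoidAlgebra.mapDomain_single

lemma laurentPerm_var (σ : Equiv.Perm (Fin d)) (i : Fin d) (n : ℤ) :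
    (laurentPerm σ (laurentVar i n) : Laurent R d) = laurentVar (σ i) n := by
  rw [laurentVar, laurentPerm_mono, laurentVar]
  congr 1
  funext j
  simp only [Function.comp_apply, Pi.single_apply, Equiv.symm_apply_eq]

lemma laurentPerm_stepPoly (σ : Equiv.Perm (Fin d)) :
    laurentPerm σ (stepPoly R d) = stepPoly R d := by
  simp only [stepPoly, map_sum, map_add, laurentPerm_var]
  exact Equiv.sum_comp σ fun k => laurentVar k 1 + laurentVar k (-1)

end Laurent

section Antisymmetric

variable {R : Type*} [CommRing R] {d : ℕ}

/-- Functions of lattice points that change by the sign of a permutation of the coordinates. -/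
def IsAntisymm (φ : (Fin d → ℤ) → R) : Prop :=
  ∀ (σ : Equiv.Perm (Fin d)) y, φ (y ∘ σ) = (Equiv.Perm.sign σ : ℤ) * φ y

lemma IsAntisymm.laurentPairing_perm {φ : (Fin d → ℤ) → R} (hφ : IsAntisymm φ)
    (σ : Equiv.Perm (Fin d)) (g : Laurent R d) :
    laurentPairing φ (laurentPerm σ g) = (Equiv.Perm.sign σ : ℤ) * laurentPairing φ g := by
  have hlin : laurentPairing φ ∘ₗ (laurentPerm σ).toLinearMap =
      ((Equiv.Perm.sign σ : ℤ) : R) • laurentPairing φ := laurent_hom_ext fun y => by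
    rw [LinearMap.comp_apply, AlgHom.toLinearMap_apply, laurentPerm_mono, LinearMap.smul_apply,
      laurentPairing_mono, laurentPairing_mono, hφ, Equiv.Perm.sign_symm, smul_eq_mul]
  exact LinearMap.congr_fun hlin g

lemma IsAntisymm.laurentPairing_det_mul {φ : (Fin d → ℤ) → R} (hφ : IsAntisymm φ)
    {Q : Matrix (Fin d) (Fin d) (Laurent R d)}
    (hQ : ∀ σ i j, laurentPerm σ (Q i j) = Q (σ i) j)
    {h : Laurent R d} (hh : ∀ σ, laurentPerm σ h = h) :
    laurentPairing φ (Q.det * h) = d.factorial * laurentPairing φ ((∏ i, Q i i) * h) := by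
  have hterm (σ : Equiv.Perm (Fin d)) :
      laurentPairing φ ((Equiv.Perm.sign σ • ∏ i, Q (σ i) i) * h) =
        laurentPairing φ ((∏ i, Q i i) * h) := by
    have hperm : (∏ i, Q (σ i) i) * h = laurentPerm σ ((∏ i, Q i i) * h) := by
      simp only [map_mul, map_prod, hh, hQ]
    have hsign : ((Equiv.Perm.sign σ : ℤ) : R) * (Equiv.Perm.sign σ : ℤ) = 1 := by
      rw [← Int.cast_mul, ← Units.val_mul, Int.units_mul_self, Units.val_one, Int.cast_one]
    rw [smul_mul_assoc, hperm, Units.smul_def, map_zsmul, hφ.laurentPairing_perm, zsmul_eq_mul,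
      ← mul_assoc, hsign, one_mul]
  rw [Matrix.det_apply, sum_mul, map_sum, sum_congr rfl fun σ _ => hterm σ, sum_const, card_univ,
    Fintype.card_perm, Fintype.card_fin, nsmul_eq_mul]

/-- The antisymmetric extension of the indicator function of the chamber `0 < y_1 < ⋯ < y_d` to the
positive orthant, and by zero outside of it. -/
noncomputable def chamberSign (y : Fin d → ℤ) : R :=
  if ∀ i, 0 < y i then (vandermondeSign univ y : ℤ) else 0

lemma isAntisymm_chamberSign : IsAntisymm (chamberSign : (Fin d → ℤ) → R) := by
  intro σ y
  have hpos : (∀ i, 0 < (y ∘ σ) i) ↔ ∀ i, 0 < y i := σ.forall_congr_right (q := fun i => 0 < y i)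
  have hsign : vandermondeSign univ (y ∘ σ) = Equiv.Perm.sign σ * vandermondeSign univ y := by
    simp only [vandermondeSign, pairProd_univ]
    exact Equiv.Perm.prod_Ioi_comp_eq_sign_mul_prod σ (f := fun i j => (y j - y i).sign)
      fun i j => by rw [← Int.sign_neg, neg_sub]
  rw [chamberSign, chamberSign, if_congr hpos rfl rfl, mul_ite, mul_zero, hsign, Int.cast_mul]

lemma chamberSign_eq_one {y : Fin d → ℤ} (hmono : StrictMono y) (hpos : ∀ i, 0 < y i) :
    (chamberSign y : R) = 1 := by
  rw [chamberSign, if_pos hpos, vandermondeSign, pairProd_univ, prod_eq_one fun i _ => ?_,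
    Int.cast_one]
  exact prod_eq_one fun j hij => Int.sign_eq_one_of_pos (sub_pos.2 (hmono (mem_Ioi.1 hij)))

lemma chamberSign_eq_zero {y : Fin d → ℤ} {i : Fin d} (h : y i < 0) : (chamberSign y : R) = 0 :=
  if_neg fun hpos => (hpos i).not_gt h

end Antisymmetric

/-! ### The reflection principle -/

section SignedWalkSum

variable {R : Type*} [CommRing R] {d : ℕ}

/-- The odd Laurent polynomial `z_i ^ a - z_i ^ (-a)`, an entry of the symplectic alternant. -/
noncomputable def oddVar (i : Fin d) (a : ℤ) : Laurent R d := laurentVar i a - laurentVar i (-a)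

lemma oddVar_zero (i : Fin d) : (oddVar i 0 : Laurent R d) = 0 := by
  rw [oddVar, neg_zero, sub_self]

lemma laurentPerm_oddVar (σ : Equiv.Perm (Fin d)) (i : Fin d) (a : ℤ) :
    (laurentPerm σ (oddVar i a) : Laurent R d) = oddVar (σ i) a := by
  rw [oddVar, map_sub, laurentPerm_var, laurentPerm_var, oddVar]

lemma oddVar_mul_step (i : Fin d) (a : ℤ) :
    oddVar i a * (laurentVar i 1 + laurentVar i (-1) : Laurent R d) =
      oddVar i (a + 1) + oddVar i (a - 1) := by
  simp only [oddVar, sub_mul, mul_add, laurentVar_mul, neg_add, neg_sub, ← sub_eq_add_neg]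
  rw [sub_eq_add_neg 1 a, add_comm 1]
  ring

lemma prod_oddVar_mul_step (x : Fin d → ℤ) (k : Fin d) :
    (∏ i, oddVar i (x i)) * (laurentVar k 1 + laurentVar k (-1) : Laurent R d) =
      ∏ i, oddVar i ((x + Pi.single k 1 : Fin d → ℤ) i) +
        ∏ i, oddVar i ((x - Pi.single k 1 : Fin d → ℤ) i) := by
  have hsplit (y : Fin d → ℤ) (hy : ∀ i ≠ k, y i = x i) : ∏ i, (oddVar i (y i) : Laurent R d) =
      oddVar k (y k) * ∏ i ∈ univ.erase k, oddVar i (x i) := by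
    rw [← mul_prod_erase univ _ (mem_univ k)]
    exact congrArg _ (prod_congr rfl fun i hi => by rw [hy i (ne_of_mem_erase hi)])
  rw [hsplit x fun _ _ => rfl,
    hsplit (x + Pi.single k 1) fun i hi => by
      rw [Pi.add_apply, Pi.single_eq_of_ne hi, add_zero],
    hsplit (x - Pi.single k 1) fun i hi => by
      rw [Pi.sub_apply, Pi.single_eq_of_ne hi, sub_zero],
    Pi.add_apply, Pi.sub_apply, Pi.single_eq_same, mul_right_comm, oddVar_mul_step, add_mul]

/-- The number of walks of length `n` to the chamber `0 < y_1 < ⋯ < y_d` from the images of `x`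
under the hyperoctahedral group, counted with the sign of the group element. -/
noncomputable def signedWalkSum (R : Type*) [CommRing R] (n : ℕ) (x : Fin d → ℤ) : R :=
  laurentPairing chamberSign ((∏ i, oddVar i (x i)) * stepPoly R d ^ n)

lemma signedWalkSum_succ (n : ℕ) (x : Fin d → ℤ) :
    signedWalkSum R (n + 1) x =
      ∑ k, (signedWalkSum R n (x + Pi.single k 1) + signedWalkSum R n (x - Pi.single k 1)) := by
  simp only [signedWalkSum]
  rw [pow_succ', ← mul_assoc]
  nth_rewrite 1 [stepPoly]
  rw [mul_sum, sum_mul, map_sum]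
  exact sum_congr rfl fun k _ => by rw [prod_oddVar_mul_step, add_mul, map_add]

lemma signedWalkSum_eq_zero_of_apply_eq_zero (n : ℕ) {x : Fin d → ℤ} {i : Fin d} (h : x i = 0) :
    signedWalkSum R n x = 0 := by
  rw [signedWalkSum, prod_eq_zero (mem_univ i) (by rw [h, oddVar_zero]), zero_mul, map_zero]

lemma signedWalkSum_eq_zero_of_not_injective [IsAddTorsionFree R] (n : ℕ) {x : Fin d → ℤ}
    (hx : ¬ Function.Injective x) : signedWalkSum R n x = 0 := by
  obtain ⟨i, j, hij, hne⟩ := Function.not_injective_iff.1 hx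
  have hprod : laurentPerm (Equiv.swap i j) (∏ k, oddVar k (x k)) =
      (∏ k, oddVar k (x k) : Laurent R d) := by
    rw [map_prod, ← Equiv.prod_comp (Equiv.swap i j) fun k => (oddVar k (x k) : Laurent R d)]
    refine prod_congr rfl fun k _ => ?_
    rw [laurentPerm_oddVar, Equiv.apply_swap_eq_self hij]
  have hneg := isAntisymm_chamberSign.laurentPairing_perm (Equiv.swap i j)
    ((∏ k, oddVar k (x k)) * stepPoly R d ^ n)
  rw [map_mul, map_pow, laurentPerm_stepPoly, hprod, Equiv.Perm.sign_swap hne, Units.val_neg,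
    Units.val_one, Int.cast_neg, Int.cast_one, neg_one_mul] at hneg
  exact self_eq_neg.1 hneg

lemma signedWalkSum_zero {x : Fin d → ℤ} (hmono : StrictMono x) (hpos : ∀ i, 0 < x i) :
    signedWalkSum R 0 x = 1 := by
  have hodd (i : Fin d) : (oddVar i (x i) : Laurent R d) =
      (1 : R) • laurentVar i (x i) + (-1 : R) • laurentVar i (-x i) := by
    rw [oddVar, one_smul, neg_one_smul, sub_eq_add_neg]
  rw [signedWalkSum, pow_zero, mul_one, prod_congr rfl fun i _ => hodd i,
    prod_smul_laurentVar_add (fun _ => 1) (fun _ => -1) x fun i => -x i, map_sum,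
    sum_eq_single_of_mem univ (mem_univ _)]
  · simp only [piecewise_univ, prod_const_one, one_smul, laurentPairing_mono,
      chamberSign_eq_one hmono hpos]
  · intro t _ ht
    obtain ⟨i, hi⟩ := not_forall.1 (mt eq_univ_iff_forall.2 ht)
    rw [map_smul, laurentPairing_mono, chamberSign_eq_zero (i := i), smul_zero]
    rw [piecewise_eq_of_notMem _ _ _ hi]
    exact neg_neg_of_pos (hpos i)

open Relation in
/-- The coordinates are reversed because those in `weylChamber` decrease, whereas `chamberSign` is
normalized to be `1` at increasing positive ones. -/
theorem encard_pathSet_weylChamber [IsAddTorsionFree R] (n : ℕ) {x : Fin d → ℤ}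
    (hx : x ∈ weylChamber d) :
    ∃ N : ℕ, (N : R) = signedWalkSum R n (x ∘ Fin.rev) ∧
      (pathSet (SymmGen AddsOne) (weylChamber d) n x).encard = N := by
  refine encard_pathSet_eq_of_recursion (f := fun n x => signedWalkSum R n (x ∘ Fin.rev))
    ?_ ?_ ?_ ?_ n hx
  · exact fun x hx => signedWalkSum_zero (hx.1.comp Fin.rev_strictAnti) fun i => hx.2 _
  · intro n x
    have hsingle (k : Fin d) : (Pi.single (Fin.revPerm k) 1 : Fin d → ℤ) =
        (Pi.single k 1 : Fin d → ℤ) ∘ Fin.rev := by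
      funext i
      simp only [Function.comp_apply, Pi.single_apply, Fin.revPerm_apply, Fin.rev_eq_iff]
    rw [signedWalkSum_succ, ← Equiv.sum_comp Fin.revPerm]
    exact sum_congr rfl fun k _ => by rw [hsingle]; rfl
  · exact fun n x h => signedWalkSum_eq_zero_of_not_injective n
      (mt (Function.Injective.of_comp_right · Fin.rev_surjective) h)
  · exact fun n x i h => signedWalkSum_eq_zero_of_apply_eq_zero n (i := i.rev)
      (by rw [Function.comp_apply, Fin.rev_rev, h])

end SignedWalkSum

/-! ### The symplectic and the ordinary alternants -/

section Chebyshev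

open Polynomial

variable {R : Type*} [CommRing R]

lemma chebyshev_S_natDegree_and_monic [Nontrivial R] (n : ℕ) :
    (Chebyshev.S R n).natDegree = n ∧ (Chebyshev.S R n).Monic := by
  induction n using Nat.twoStepInduction with
  | zero => simp
  | one => simp [monic_X]
  | more n ih ih_succ =>
    have hdeg : (X * Chebyshev.S R (n + 1 : ℕ)).natDegree = n + 2 := by
      rw [natDegree_X_mul ih_succ.2.ne_zero, ih_succ.1]
    have hlt : (Chebyshev.S R n).natDegree < (X * Chebyshev.S R (n + 1 : ℕ)).natDegree := by
      rw [ih.1, hdeg]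
      exact Nat.lt_add_of_pos_right two_pos
    rw [Nat.cast_add n 2, Nat.cast_two, Chebyshev.S_add_two, ← Nat.cast_succ]
    exact ⟨by rw [natDegree_sub_eq_left_of_natDegree_lt hlt, hdeg],
      (monic_X.mul ih_succ.2).sub_of_left (degree_lt_degree hlt)⟩

lemma oddVar_eq_chebyshev {d : ℕ} (i : Fin d) (n : ℕ) :
    (oddVar i (n + 1) : Laurent R d) =
      oddVar i 1 * (Chebyshev.S (Laurent R d) n).eval (laurentVar i 1 + laurentVar i (-1)) := by
  induction n using Nat.twoStepInduction with
  | zero => simp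
  | one =>
    have hstep := oddVar_mul_step (R := R) i 1
    rw [sub_self, oddVar_zero, add_zero] at hstep
    rw [Nat.cast_one, Chebyshev.S_one, eval_X, hstep]
  | more n ih ih_succ =>
    have hstep := oddVar_mul_step (R := R) i (n + 1 + 1)
    rw [add_sub_cancel_right, ih, ← Nat.cast_succ, ih_succ] at hstep
    rw [Nat.cast_add n 2, Nat.cast_two, Chebyshev.S_add_two, ← Nat.cast_succ, eval_sub, eval_mul,
      eval_X, show (n : ℤ) + 2 + 1 = (n + 1 : ℕ) + 1 + 1 by push_cast; ring,
      eq_sub_of_add_eq hstep.symm]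
    ring

end Chebyshev

section Alternants

variable {R : Type*} [CommRing R] {d : ℕ}

lemma laurentVar_one_mul_neg_one (i : Fin d) :
    (laurentVar i 1 * laurentVar i (-1) : Laurent R d) = 1 := by
  rw [laurentVar_mul, add_neg_cancel, laurentVar_zero]

/-- The ratio of the symplectic alternant `det (z_i ^ j - z_i ^ (-j))` to the ordinary alternant
`det (z_i ^ (j - 1) + z_i ^ j)`. It only involves the inverse variables. -/
noncomputable def alternantRatio (R : Type*) [CommRing R] (d : ℕ) : Laurent R d :=
  (∏ i, (1 - laurentVar i (-1))) *
    pairProd univ fun i j => 1 - laurentVar i (-1) * laurentVar j (-1)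

lemma det_oddVar_eq_prod [Nontrivial R] :
    (Matrix.of fun i j : Fin d => (oddVar i (j + 1) : Laurent R d)).det =
      (∏ i, oddVar i 1) * ∏ i, ∏ j ∈ Ioi i,
        (laurentVar j 1 + laurentVar j (-1) - (laurentVar i 1 + laurentVar i (-1))) := by
  simp only [oddVar_eq_chebyshev]
  refine (Matrix.det_mul_column _ (Matrix.of fun i j : Fin d =>
    (Polynomial.Chebyshev.S (Laurent R d) (j : ℕ)).eval
      (laurentVar i 1 + laurentVar i (-1)))).trans ?_
  rw [← Matrix.det_eval_matrixOfPolynomials_eq_det_vandermonde _ _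
    (fun j => (chebyshev_S_natDegree_and_monic _).1)
    (fun j => (chebyshev_S_natDegree_and_monic _).2), Matrix.det_vandermonde]

lemma det_laurentVar_add_eq_prod :
    (Matrix.of fun i j : Fin d => (laurentVar i j + laurentVar i (j + 1) : Laurent R d)).det =
      (∏ i, (1 + laurentVar i 1)) * ∏ i, ∏ j ∈ Ioi i, (laurentVar j 1 - laurentVar i 1) := by
  rw [← Matrix.det_vandermonde, ← Matrix.det_mul_column]
  congr 1
  ext1 i j
  rw [Matrix.of_apply, Matrix.of_apply, Matrix.vandermonde_apply, laurentVar_pow, add_mul,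
    one_mul, laurentVar_mul, mul_one, add_comm (1 : ℤ)]

theorem det_oddVar [Nontrivial R] :
    (Matrix.of fun i j : Fin d => (oddVar i (j + 1) : Laurent R d)).det = alternantRatio R d *
      (Matrix.of fun i j : Fin d => laurentVar i j + laurentVar i (j + 1)).det := by
  have hinv := laurentVar_one_mul_neg_one (R := R) (d := d)
  rw [det_oddVar_eq_prod, det_laurentVar_add_eq_prod, alternantRatio, pairProd_univ,
    mul_mul_mul_comm]
  congr 1
  · rw [← prod_mul_distrib]
    refine prod_congr rfl fun i _ => ?_
    rw [oddVar]
    linear_combination hinv i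
  · rw [← prod_mul_distrib]
    refine prod_congr rfl fun i _ => ?_
    rw [← prod_mul_distrib]
    refine prod_congr rfl fun j _ => ?_
    linear_combination laurentVar i (-1) * hinv j - laurentVar j (-1) * hinv i

end Alternants

/-! ### Littlewood's identity as an identity of functionals -/

section LatticeCoeff

variable {R : Type*} [CommRing R] {d : ℕ}

/-- The coefficient of a power series at a lattice point `x`, which is zero if `x` lies outside of
the positive orthant. -/
noncomputable def latticeCoeff (x : Fin d → ℤ) : MvPowerSeries (Fin d) R →ₗ[R] R :=
  if ∀ i, 0 ≤ x i then
    MvPowerSeries.coeff (Finsupp.equivFunOnFinite.symm fun i => (x i).toNat)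
  else 0

lemma latticeCoeff_natCast (m : Fin d →₀ ℕ) :
    latticeCoeff (fun i => (m i : ℤ)) = (MvPowerSeries.coeff m : _ →ₗ[R] R) := by
  rw [latticeCoeff, if_pos fun i => Int.natCast_nonneg _]
  congr 1
  ext i
  rfl

lemma latticeCoeff_of_neg {x : Fin d → ℤ} {i : Fin d} (h : x i < 0) :
    (latticeCoeff x : _ →ₗ[R] R) = 0 :=
  if_neg fun hx => (hx i).not_gt h

lemma exists_eq_natCast_or_exists_neg (x : Fin d → ℤ) :
    (∃ m : Fin d →₀ ℕ, x = fun i => (m i : ℤ)) ∨ ∃ i, x i < 0 := by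
  refine or_iff_not_imp_right.2 fun h => ?_
  push Not at h
  exact ⟨Finsupp.equivFunOnFinite.symm fun i => (x i).toNat,
    funext fun i => (Int.toNat_of_nonneg (h i)).symm⟩

lemma latticeCoeff_monomial_mul (x : Fin d → ℤ) (m : Fin d →₀ ℕ) (a : R)
    (G : MvPowerSeries (Fin d) R) :
    latticeCoeff x (MvPowerSeries.monomial m a * G) =
      a * latticeCoeff (fun i => x i - m i) G := by
  classical
  obtain ⟨n, rfl⟩ | ⟨i, hi⟩ := exists_eq_natCast_or_exists_neg x
  · rw [latticeCoeff_natCast, MvPowerSeries.coeff_monomial_mul]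
    split_ifs with hle
    · rw [← latticeCoeff_natCast]
      congr 3
      funext i
      exact Nat.cast_sub (hle i)
    · obtain ⟨i, hi⟩ := not_forall.1 hle
      rw [latticeCoeff_of_neg (i := i) (sub_neg.2 (Nat.cast_lt.2 (not_le.1 hi))),
        LinearMap.zero_apply, mul_zero]
  · rw [latticeCoeff_of_neg hi, latticeCoeff_of_neg (i := i) (by omega), LinearMap.zero_apply,
      LinearMap.zero_apply, mul_zero]

lemma aeval_laurentVar_monomial (m : Fin d →₀ ℕ) (a : R) :
    MvPolynomial.aeval (fun i : Fin d => (laurentVar i (-1) : Laurent R d))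
      (MvPolynomial.monomial m a) = a • laurentMono fun i => -(m i : ℤ) := by
  rw [MvPolynomial.aeval_monomial, Finsupp.prod_fintype _ _ fun i => pow_zero _, Algebra.smul_def,
    ← prod_laurentVar]
  simp only [laurentVar_pow, mul_neg_one]

lemma laurentPairing_aeval_mul (G : MvPowerSeries (Fin d) R) (P : MvPolynomial (Fin d) R)
    (g : Laurent R d) :
    laurentPairing (fun y => latticeCoeff y G)
        (MvPolynomial.aeval (fun i : Fin d => laurentVar i (-1)) P * g) =
      laurentPairing (fun y => latticeCoeff y ((P : MvPowerSeries (Fin d) R) * G)) g := by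
  induction P using MvPolynomial.induction_on' with
  | monomial m a =>
    have hlin : laurentPairing (fun y => latticeCoeff y G) ∘ₗ
          LinearMap.mulLeft R (MvPolynomial.aeval (fun i : Fin d => laurentVar i (-1))
            (MvPolynomial.monomial m a)) =
        laurentPairing fun y => latticeCoeff y (MvPowerSeries.monomial m a * G) := by
      refine laurent_hom_ext fun x => ?_
      rw [LinearMap.comp_apply, LinearMap.mulLeft_apply, aeval_laurentVar_monomial,
        smul_mul_assoc, laurentMono_mul, map_smul, laurentPairing_mono, laurentPairing_mono,
        latticeCoeff_monomial_mul, smul_eq_mul]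
      congr 3
      funext i
      exact neg_add_eq_sub _ _
    rw [MvPolynomial.coe_monomial]
    exact LinearMap.congr_fun hlin g
  | add P Q ihP ihQ =>
    have hadd : laurentPairing (fun y => latticeCoeff y
          (((P + Q : MvPolynomial (Fin d) R) : MvPowerSeries (Fin d) R) * G)) =
        laurentPairing (fun y => latticeCoeff y ((P : MvPowerSeries (Fin d) R) * G)) +
          laurentPairing fun y => latticeCoeff y ((Q : MvPowerSeries (Fin d) R) * G) :=
      laurent_hom_ext fun x => by
        simp only [LinearMap.add_apply, laurentPairing_mono, MvPolynomial.coe_add, add_mul,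
          map_add]
    rw [map_add, add_mul, map_add, ihP, ihQ, hadd, LinearMap.add_apply]

lemma chamberSign_eq_latticeCoeff (y : Fin d → ℤ) :
    (chamberSign y : R) = latticeCoeff y ((∏ i, MvPowerSeries.X i) * orderSeries univ) := by
  obtain ⟨m, rfl⟩ | ⟨i, hi⟩ := exists_eq_natCast_or_exists_neg y
  · rw [chamberSign, latticeCoeff_natCast, coeff_prod_X_mul_orderSeries]
    refine if_congr ?_ rfl rfl
    simp only [eq_univ_iff_forall, Finsupp.mem_support_iff, Int.natCast_pos, Nat.pos_iff_ne_zero]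
  · rw [chamberSign_eq_zero hi, latticeCoeff_of_neg hi, LinearMap.zero_apply]

end LatticeCoeff

section AlternantCoeff

variable {R : Type*} [CommRing R] {d : ℕ}

/-- The sign of `y` if `y` is a permutation of `1, …, d`, and zero otherwise. -/
noncomputable def alternantCoeff (y : Fin d → ℤ) : R :=
  (Matrix.of fun i j : Fin d => if y i = j + 1 then (1 : R) else 0).det

lemma isAntisymm_alternantCoeff : IsAntisymm (alternantCoeff : (Fin d → ℤ) → R) := fun σ y =>
  Matrix.det_permute σ (Matrix.of fun i j : Fin d => if y i = j + 1 then (1 : R) else 0)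

lemma alternantCoeff_eq_sum (y : Fin d → ℤ) :
    (alternantCoeff y : R) = ∑ σ : Equiv.Perm (Fin d),
      Equiv.Perm.sign σ • if ∀ i, y i = σ i + 1 then (1 : R) else 0 := by
  rw [alternantCoeff, ← Matrix.det_transpose, Matrix.det_apply]
  simp only [Matrix.transpose_apply, Matrix.of_apply, prod_ite_zero, prod_const_one, mem_univ,
    true_imp_iff]

lemma coeff_prod_X_pow (m : Fin d →₀ ℕ) (c : Fin d → ℕ) :
    MvPowerSeries.coeff m (∏ i, (MvPowerSeries.X i : MvPowerSeries (Fin d) R) ^ c i) =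
      if ∀ i, m i = c i then 1 else 0 := by
  classical
  have hmonomial : ∏ i, (MvPowerSeries.X i : MvPowerSeries (Fin d) R) ^ c i =
      MvPowerSeries.monomial (Finsupp.equivFunOnFinite.symm c) 1 := by
    rw [MvPowerSeries.monomial_one_eq, Finsupp.prod_fintype _ _ fun i => pow_zero _]
    rfl
  rw [hmonomial, MvPowerSeries.coeff_monomial]
  exact if_congr DFunLike.ext_iff rfl rfl

lemma prod_X_mul_vandermonde_eq_sum :
    (∏ i, MvPowerSeries.X i) * (pairProd univ fun i j => MvPowerSeries.X j - MvPowerSeries.X i) =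
      ∑ σ : Equiv.Perm (Fin d), Equiv.Perm.sign σ •
        ∏ i, (MvPowerSeries.X i : MvPowerSeries (Fin d) R) ^ ((σ i : ℕ) + 1) := by
  rw [pairProd_univ, ← Matrix.det_vandermonde, ← Matrix.det_mul_column, ← Matrix.det_transpose,
    Matrix.det_apply]
  simp only [Matrix.transpose_apply, Matrix.of_apply, Matrix.vandermonde_apply, pow_succ']

lemma latticeCoeff_prod_X_mul_vandermonde (y : Fin d → ℤ) :
    latticeCoeff y ((∏ i, MvPowerSeries.X i) *
      pairProd univ fun i j => MvPowerSeries.X j - MvPowerSeries.X i) =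
        (alternantCoeff y : R) := by
  obtain ⟨m, rfl⟩ | ⟨i, hi⟩ := exists_eq_natCast_or_exists_neg y
  · rw [latticeCoeff_natCast, prod_X_mul_vandermonde_eq_sum, map_sum, alternantCoeff_eq_sum]
    refine sum_congr rfl fun σ _ => ?_
    rw [Units.smul_def, Units.smul_def, map_zsmul, coeff_prod_X_pow]
    congr 1
    refine if_congr (forall_congr' fun i => ?_) rfl rfl
    exact_mod_cast Iff.rfl
  · rw [latticeCoeff_of_neg hi, LinearMap.zero_apply, alternantCoeff,
      Matrix.det_eq_zero_of_row_eq_zero i fun j => if_neg (by omega)]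

lemma laurentPairing_alternantRatio_mul [IsDomain R] (g : Laurent R d) :
    laurentPairing chamberSign (alternantRatio R d * g) = laurentPairing alternantCoeff g := by
  set P : MvPolynomial (Fin d) R := (∏ i, (1 - MvPolynomial.X i)) *
    pairProd univ fun i j => 1 - MvPolynomial.X i * MvPolynomial.X j with hP
  have hratio : alternantRatio R d =
      MvPolynomial.aeval (fun i : Fin d => laurentVar i (-1)) P := by
    simp only [hP, map_mul, map_prod, map_pairProd, map_sub, map_one, MvPolynomial.aeval_X,
      alternantRatio]
  have hcoe : (P : MvPowerSeries (Fin d) R) = (∏ i, (1 - MvPowerSeries.X i)) *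
      pairProd univ fun i j => 1 - MvPowerSeries.X i * MvPowerSeries.X j := by
    rw [← MvPolynomial.coeToMvPowerSeries.ringHom_apply]
    simp only [hP, map_mul, map_prod, map_pairProd, map_sub, map_one,
      MvPolynomial.coeToMvPowerSeries.ringHom_apply, MvPolynomial.coe_X]
  have hchamber : (chamberSign : (Fin d → ℤ) → R) = fun y =>
      latticeCoeff y ((∏ i, MvPowerSeries.X i) * orderSeries univ) :=
    funext chamberSign_eq_latticeCoeff
  rw [hratio, hchamber, laurentPairing_aeval_mul, hcoe, mul_left_comm, prod_mul_orderSeries]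
  congr 2
  exact funext latticeCoeff_prod_X_mul_vandermonde

end AlternantCoeff

/-! ### Bessel functions -/

section Bessel

lemma coeff_besselI (s : ℤ) (m : ℕ) : PowerSeries.coeff m (besselI s) =
    ∑ p ∈ antidiagonal m,
      if (p.1 : ℤ) - p.2 = s then 1 / ((p.1.factorial : ℚ) * p.2.factorial) else 0 :=
  PowerSeries.coeff_mk _ _

lemma constantCoeff_besselI (s : ℤ) :
    PowerSeries.constantCoeff (besselI s) = if s = 0 then 1 else 0 := by
  rw [← PowerSeries.coeff_zero_eq_constantCoeff_apply, coeff_besselI]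
  simp [eq_comm]

lemma besselI_neg (s : ℤ) : besselI (-s) = besselI s := by
  ext m
  rw [coeff_besselI, coeff_besselI, ← Nat.sum_antidiagonal_swap]
  refine sum_congr rfl fun p _ => ?_
  rw [Prod.fst_swap, Prod.snd_swap, mul_comm (p.1.factorial : ℚ)]
  exact if_congr (by omega) rfl rfl

lemma succ_div_factorial_mul_factorial (a b : ℕ) :
    ((a + 1 : ℕ) : ℚ) / ((a + 1).factorial * b.factorial) =
      1 / (a.factorial * b.factorial) := by
  rw [Nat.factorial_succ, Nat.cast_mul, mul_assoc,
    div_mul_cancel_left₀ (Nat.cast_ne_zero.2 a.succ_ne_zero), one_div]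

lemma sum_antidiagonal_fst_div_factorial (s : ℤ) (m : ℕ) :
    (∑ p ∈ antidiagonal (m + 1),
      if (p.1 : ℤ) - p.2 = s then (p.1 : ℚ) / (p.1.factorial * p.2.factorial) else 0) =
      PowerSeries.coeff m (besselI (s - 1)) := by
  rw [Nat.sum_antidiagonal_succ, coeff_besselI]
  simp only [Nat.cast_zero, zero_div, ite_self, zero_add, succ_div_factorial_mul_factorial]
  exact sum_congr rfl fun p _ => if_congr (by push_cast; omega) rfl rfl

lemma sum_antidiagonal_snd_div_factorial (s : ℤ) (m : ℕ) :
    (∑ p ∈ antidiagonal (m + 1),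
      if (p.1 : ℤ) - p.2 = s then (p.2 : ℚ) / (p.1.factorial * p.2.factorial) else 0) =
      PowerSeries.coeff m (besselI (s + 1)) := by
  rw [← besselI_neg, neg_add', ← sum_antidiagonal_fst_div_factorial, ← Nat.sum_antidiagonal_swap]
  refine sum_congr rfl fun p _ => ?_
  rw [Prod.fst_swap, Prod.snd_swap, mul_comm (p.1.factorial : ℚ)]
  exact if_congr (by omega) rfl rfl

lemma derivative_besselI (s : ℤ) :
    PowerSeries.derivative ℚ (besselI s) = besselI (s - 1) + besselI (s + 1) := by
  ext m
  rw [PowerSeries.coeff_derivative, map_add, coeff_besselI, sum_mul,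
    ← sum_antidiagonal_fst_div_factorial, ← sum_antidiagonal_snd_div_factorial, ← sum_add_distrib]
  refine sum_congr rfl fun p hp => ?_
  have hsum : (p.1 : ℚ) + p.2 = m + 1 := by exact_mod_cast mem_antidiagonal.1 hp
  split_ifs
  · rw [← hsum, ← add_div, div_mul_eq_mul_div, one_mul]
  · rw [zero_mul, add_zero]

end Bessel

lemma leibniz_prod {R A ι : Type*} [CommSemiring R] [CommSemiring A] [Algebra R A]
    [DecidableEq ι] (D : Derivation R A A) (s : Finset ι) (f : ι → A) :
    D (∏ i ∈ s, f i) = ∑ i ∈ s, D (f i) * ∏ j ∈ s.erase i, f j := by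
  induction s using Finset.induction_on with
  | empty => rw [prod_empty, D.map_one_eq_zero, sum_empty]
  | insert k s hk ih =>
    rw [prod_insert hk, D.leibniz, ih, sum_insert hk, erase_insert hk, smul_eq_mul, smul_eq_mul,
      mul_sum, add_comm, mul_comm]
    congr 1
    refine sum_congr rfl fun i hi => ?_
    have hki : k ≠ i := fun h => hk (h ▸ hi)
    rw [erase_insert_of_ne hki, prod_insert fun h => hk (mem_of_mem_erase h), mul_left_comm]

section BesselExpansion

variable {d : ℕ}

/-- The exponential generating function, by length, of the unrestricted lattice walks from the
origin to `y`. -/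
noncomputable def besselProd (y : Fin d → ℤ) : PowerSeries ℚ := ∏ i, besselI (y i)

lemma derivative_besselProd (y : Fin d → ℤ) :
    PowerSeries.derivative ℚ (besselProd y) =
      ∑ k, (besselProd (y - Pi.single k 1) + besselProd (y + Pi.single k 1)) := by
  rw [besselProd, leibniz_prod]
  refine sum_congr rfl fun k _ => ?_
  have hsplit (x : Fin d → ℤ) (hx : ∀ i ≠ k, x i = y i) : besselProd x =
      besselI (x k) * ∏ i ∈ univ.erase k, besselI (y i) := by
    rw [besselProd, ← mul_prod_erase univ _ (mem_univ k)]
    exact congrArg _ (prod_congr rfl fun i hi => by rw [hx i (ne_of_mem_erase hi)])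
  rw [hsplit (y - Pi.single k 1) fun i hi => by
      rw [Pi.sub_apply, Pi.single_eq_of_ne hi, sub_zero],
    hsplit (y + Pi.single k 1) fun i hi => by
      rw [Pi.add_apply, Pi.single_eq_of_ne hi, add_zero],
    Pi.add_apply, Pi.sub_apply, Pi.single_eq_same, derivative_besselI, add_mul]

lemma coeff_stepPoly_pow (n : ℕ) (y : Fin d → ℤ) :
    (stepPoly ℚ d ^ n).coeff y = n.factorial * PowerSeries.coeff n (besselProd y) := by
  induction n generalizing y with
  | zero =>
    rw [pow_zero, ← laurentMono_zero, laurentMono, besselProd,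
      PowerSeries.coeff_zero_eq_constantCoeff_apply, map_prod]
    simp only [constantCoeff_besselI, prod_ite_zero, prod_const_one]
    simp [Finsupp.single_apply, funext_iff, eq_comm]
  | succ n ih =>
    have hderiv := congrArg (PowerSeries.coeff n) (derivative_besselProd y)
    have hstep : stepPoly ℚ d ^ (n + 1) =
        ∑ k, (laurentVar k 1 + laurentVar k (-1)) * stepPoly ℚ d ^ n := by
      rw [pow_succ', ← sum_mul, stepPoly]
    rw [PowerSeries.coeff_derivative, map_sum] at hderiv
    rw [hstep, Nat.factorial_succ, mul_comm (n + 1), Nat.cast_mul, mul_assoc,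
      mul_comm ((n + 1 : ℕ) : ℚ), Nat.cast_succ, hderiv, mul_sum, AddMonoidAlgebra.coeff_sum,
      Finsupp.finsetSum_apply]
    refine sum_congr rfl fun k _ => ?_
    rw [add_mul, map_add, AddMonoidAlgebra.coeff_add, Finsupp.add_apply, laurentVar, laurentVar,
      coeff_laurentMono_mul, coeff_laurentMono_mul, ih, ih, Pi.single_neg, sub_neg_eq_add, mul_add]

lemma coeff_prod_laurentVar_mul_stepPoly_pow (n : ℕ) (a b y : Fin d → ℤ) :
    ((∏ i, (laurentVar i (a i) + laurentVar i (b i))) * stepPoly ℚ d ^ n).coeff y =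
      n.factorial * PowerSeries.coeff n (∏ i, (besselI (y i - a i) + besselI (y i - b i))) := by
  have hexpand := prod_smul_laurentVar_add (R := ℚ) (fun _ => 1) (fun _ => 1) a b
  simp only [one_smul, piecewise_same, prod_const_one] at hexpand
  rw [hexpand, sum_mul, AddMonoidAlgebra.coeff_sum, Finsupp.finsetSum_apply,
    prod_add_eq_sum_prod_piecewise, map_sum, mul_sum]
  refine sum_congr rfl fun t _ => ?_
  rw [coeff_laurentMono_mul, coeff_stepPoly_pow, besselProd]
  congr 2
  exact prod_congr rfl fun i _ => by by_cases hi : i ∈ t <;> simp [hi]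

lemma laurentPairing_alternantCoeff {R : Type*} [CommRing R] (g : Laurent R d) :
    laurentPairing alternantCoeff g =
      ∑ σ : Equiv.Perm (Fin d), Equiv.Perm.sign σ • g.coeff fun i => (σ i : ℤ) + 1 := by
  have hlin : laurentPairing alternantCoeff =
      ∑ σ : Equiv.Perm (Fin d), Equiv.Perm.sign σ • Finsupp.lapply (fun i => (σ i : ℤ) + 1) ∘ₗ
        (AddMonoidAlgebra.coeffLinearEquiv R).toLinearMap := laurent_hom_ext fun y => by
    rw [laurentPairing_mono, alternantCoeff_eq_sum, LinearMap.sum_apply]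
    simp [laurentMono, Finsupp.single_apply, funext_iff]
  rw [hlin, LinearMap.sum_apply]
  rfl

theorem signedWalkSum_eq_coeff_det (d n : ℕ) :
    signedWalkSum ℚ n (fun i : Fin d => (i : ℤ) + 1) =
      n.factorial * PowerSeries.coeff n (besselMatrix d).det := by
  have hstep (σ : Equiv.Perm (Fin d)) : laurentPerm σ (stepPoly ℚ d ^ n) = stepPoly ℚ d ^ n := by
    rw [map_pow, laurentPerm_stepPoly]
  have hsymplectic := isAntisymm_chamberSign.laurentPairing_det_mul
    (Q := Matrix.of fun i j : Fin d => oddVar i (j + 1))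
    (fun σ i j => laurentPerm_oddVar σ i _) hstep
  have hordinary := isAntisymm_alternantCoeff.laurentPairing_det_mul
    (Q := Matrix.of fun i j : Fin d => laurentVar i j + laurentVar i (j + 1))
    (fun σ i j => by simp only [Matrix.of_apply, map_add, laurentPerm_var]) hstep
  rw [det_oddVar, mul_assoc, laurentPairing_alternantRatio_mul, hordinary] at hsymplectic
  have hdiag := mul_left_cancel₀ (Nat.cast_ne_zero.2 d.factorial_ne_zero) hsymplectic
  simp only [Matrix.of_apply] at hdiag
  rw [signedWalkSum, ← hdiag, laurentPairing_alternantCoeff, ← Matrix.det_transpose,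
    Matrix.det_apply, map_sum, mul_sum]
  refine sum_congr rfl fun σ _ => ?_
  rw [coeff_prod_laurentVar_mul_stepPoly_pow n (fun i : Fin d => (i : ℤ)) fun i => (i : ℤ) + 1,
    Units.smul_def, Units.smul_def, map_zsmul, mul_smul_comm]
  congr 3
  refine prod_congr rfl fun i _ => ?_
  rw [Matrix.transpose_apply, besselMatrix, Matrix.of_apply, ← besselI_neg ((i : ℤ) - σ i),
    ← besselI_neg ((i : ℤ) - σ i - 1), add_comm]
  congr 2 <;> ring

end BesselExpansion

lemma weylDelta_mem_weylChamber (d : ℕ) : weylDelta d ∈ weylChamber d := by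
  refine ⟨fun i j hij => ?_, fun i => ?_⟩
  · exact sub_lt_sub_left (Nat.cast_lt.2 hij) _
  · exact sub_pos.2 (Nat.cast_lt.2 i.isLt)

lemma weylDelta_comp_rev (d : ℕ) : weylDelta d ∘ Fin.rev = fun i : Fin d => (i : ℤ) + 1 := by
  funext i
  have hi := i.isLt
  simp only [weylDelta, Function.comp_apply, Fin.val_rev]
  omega

end Osc

theorem mainTheorem3 (d n : ℕ) :
    ∃ N : ℕ,
      (N : ℚ) = (n.factorial : ℚ) * PowerSeries.coeff n (Osc.besselMatrix d).det ∧
      (Osc.palindromicWalks d n).encard = N ∧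
      (Osc.palindromicTableaux d n).encard = N ∧
      (Osc.symmetricNoncrossing d n).encard = N ∧
      (Osc.symmetricNonnesting d n).encard = N ∧
      (Osc.boundedTableaux d n).encard = N := by
  obtain ⟨N, hN, hwalks⟩ :=
    Osc.encard_pathSet_weylChamber (R := ℚ) n (Osc.weylDelta_mem_weylChamber d)
  rw [Osc.weylDelta_comp_rev, Osc.signedWalkSum_eq_coeff_det] at hN
  have htableaux := (Osc.encard_boundedTableaux d n).trans hwalks
  exact ⟨N, hN, (Osc.encard_palindromicWalks d n).trans hwalks,
    (Osc.encard_palindromicTableaux d n).trans htableaux,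
    (Osc.encard_symmetricNoncrossing d n).trans htableaux,
    (Osc.encard_symmetricNonnesting d n).trans htableaux, htableaux⟩
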